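/- For real numbers $\theta,\phi,\alpha\in[0,\pi/2]$, $\beta\in[0,2\pi]$ and $\nu_1,\nu_2\in[0,1]$ with $\nu_1+\nu_2=1$, consider the two-qubit state (of rank $1$ or $2$) $$\rho=\nu_1|\psi_1\rangle\langle\psi_1|+\nu_2|\psi_2\rangle\langle\psi_2|,$$ $$|\psi_1\rangle=\cos\theta|00\rangle+\sin\theta|11\rangle,\qquad |\psi_2\rangle=\cos\phi\,(\cos\alpha|01\rangle+\sin\alpha|10\rangle)+e^{i\beta}\sin\phi\,(\sin\theta|00\rangle-\cos\theta|11\rangle).$$ For a measurement direction $\hat n=(\sin\xi\cos\tau,\sin\xi\sin\tau,\cos\xi)$ of Alice (who holds the first qubit), with $\xi,\tau\in\mathbb R$, let $$|{+\hat n}\rangle=\cos\tfrac{\xi}{2}|0\rangle+e^{i\tau}\sin\tfrac{\xi}{2}|1\rangle,\qquad |{-\hat n}\rangle=\sin\tfrac{\xi}{2}|0\rangle-e^{i\tau}\cos\tfrac{\xi}{2}|1\rangle,$$ and let $\mathcal M=(\langle{+\hat n}|\otimes 1)\,\rho\,(|{-\hat n}\rangle\otimes 1)$ be the off-diagonal block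 in $$\rho=|{+\hat n}\rangle\langle{+\hat n}|\otimes\tilde\rho_0^{\hat n}+|{-\hat n}\rangle\langle{-\hat n}|\otimes\tilde\rho_1^{\hat n}+|{+\hat n}\rangle\langle{-\hat n}|\otimes\mathcal M+|{-\hat n}\rangle\langle{+\hat n}|\otimes\mathcal M^\dagger .$$ A state is separable if it is a finite convex combination of products of one-qubit density matrices. 1. For all parameters in these ranges, if $\mathcal M=\mathcal M^\dagger$ for some direction $(\xi,\tau)$, then $\rho$ is separable. 2. If $\theta\neq\pi/4$, or $\theta=\pi/4$ and $\phi\in\{0,\pi/2\}$, then $\rho$ is separable if and only if there are $\xi,\tau$ with $\mathcal M=\mathcal M^\dagger$. 3. Every two-qubit density matrix $\sigma$ of rank at most $2$ can be brought by a local unitary transformation, $\sigma\mapsto(U\otimes V)\,\sigma\,(U\otimes V)^\dagger$, to a state $\rho$ of the above form (the normal form) in which $\theta=\pi/4$ occurs only with $\phi=0,\ \alpha=\pi/4$ (so $|\psi_2\rangle=(|01\rangle+|10\rangle)/\sqrt2$) or with $\phi=\pi/2$ (so $|\psi_2\rangle=(|00\rangle-|11\rangle)/\sqrt2$ up to a phase),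 and $\sigma$ is separable if and only if $\mathcal M=\mathcal M^\dagger$ for this $\rho$ and some $\xi,\tau$. -/

import Mathlib

open scoped Matrix Kronecker ComplexOrder

noncomputable section

namespace TwoQubit

/-- One-qubit operators, in the computational basis `|0⟩, |1⟩`. -/
abbrev Op1 := Matrix (Fin 2) (Fin 2) ℂ

/-- Two-qubit operators; the index `(i, j)` stands for `|i⟩ ⊗ |j⟩`, with Alice's qubit first. -/
abbrev Op2 := Matrix (Fin 2 × Fin 2) (Fin 2 × Fin 2) ℂ

/-- A density matrix: positive semidefinite of trace one. -/
def IsDensity {ι : Type} [Fintype ι] (ρ : Matrix ι ι ℂ) : Prop :=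
  ρ.PosSemidef ∧ ρ.trace = 1

/-- Separable states: finite convex combinations of products of one-qubit density matrices. -/
def IsSeparable (ρ : Op2) : Prop :=
  ρ ∈ convexHull ℝ {σ : Op2 | ∃ A B : Op1, IsDensity A ∧ IsDensity B ∧ σ = A ⊗ₖ B}

/-- `|i j⟩`. -/
def ket (i j : Fin 2) : Fin 2 × Fin 2 → ℂ := Pi.single (i, j) 1

/-- `|u⟩⟨v|`. -/
def ketbra {ι : Type} (u v : ι → ℂ) : Matrix ι ι ℂ := Matrix.vecMulVec u (star v)

/-- The parameters of the normal form: two weights and four angles. -/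
structure Params where
  ν₁ : ℝ
  ν₂ : ℝ
  θ : ℝ
  φ : ℝ
  α : ℝ
  β : ℝ

namespace Params

/-- `cos θ |00⟩ + sin θ |11⟩`. -/
def ψ₁ (p : Params) : Fin 2 × Fin 2 → ℂ :=
  (Real.cos p.θ : ℂ) • ket 0 0 + (Real.sin p.θ : ℂ) • ket 1 1

/-- `cos φ (cos α |01⟩ + sin α |10⟩) + e^{iβ} sin φ (sin θ |00⟩ - cos θ |11⟩)`. -/
def ψ₂ (p : Params) : Fin 2 × Fin 2 → ℂ :=
  (Real.cos p.φ : ℂ) • ((Real.cos p.α : ℂ) • ket 0 1 + (Real.sin p.α : ℂ) • ket 1 0) +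
    (Complex.exp (Complex.I * p.β) * (Real.sin p.φ : ℂ)) •
      ((Real.sin p.θ : ℂ) • ket 0 0 - (Real.cos p.θ : ℂ) • ket 1 1)

/-- `ρ = ν₁ |ψ₁⟩⟨ψ₁| + ν₂ |ψ₂⟩⟨ψ₂|`. -/
def state (p : Params) : Op2 :=
  (p.ν₁ : ℂ) • ketbra p.ψ₁ p.ψ₁ + (p.ν₂ : ℂ) • ketbra p.ψ₂ p.ψ₂

/-- The ranges of the parameters. -/
def InRange (p : Params) : Prop :=
  p.θ ∈ Set.Icc 0 (Real.pi / 2) ∧ p.φ ∈ Set.Icc 0 (Real.pi / 2) ∧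
  p.α ∈ Set.Icc 0 (Real.pi / 2) ∧ p.β ∈ Set.Icc 0 (2 * Real.pi) ∧
  p.ν₁ ∈ Set.Icc 0 1 ∧ p.ν₂ ∈ Set.Icc 0 1 ∧ p.ν₁ + p.ν₂ = 1

/-- The normal form: if `|ψ₁⟩` is maximally entangled (`θ = π/4`), then `|ψ₂⟩` is
`(|01⟩ + |10⟩)/√2` or, up to a phase, `(|00⟩ - |11⟩)/√2`. -/
def IsNormal (p : Params) : Prop :=
  p.InRange ∧
    (p.θ = Real.pi / 4 → (p.φ = 0 ∧ p.α = Real.pi / 4) ∨ p.φ = Real.pi / 2)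

end Params

/-- `|+n⟩` for the direction `n = (sin ξ cos τ, sin ξ sin τ, cos ξ)`. -/
def ketPlus (ξ τ : ℝ) : Fin 2 → ℂ :=
  ![(Real.cos (ξ / 2) : ℂ), (Real.sin (ξ / 2) : ℂ) * Complex.exp (Complex.I * τ)]

/-- `|-n⟩` for the direction `n = (sin ξ cos τ, sin ξ sin τ, cos ξ)`. -/
def ketMinus (ξ τ : ℝ) : Fin 2 → ℂ :=
  ![(Real.sin (ξ / 2) : ℂ), -((Real.cos (ξ / 2) : ℂ) * Complex.exp (Complex.I * τ))]

/-- The operator `(⟨u| ⊗ 1) ρ (|v⟩ ⊗ 1)` on Bob's qubit, for vectors `u`, `v` of Alice's. -/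
def aliceBlock (ρ : Op2) (u v : Fin 2 → ℂ) : Op1 :=
  Matrix.of fun j l => ∑ i, ∑ k, star (u i) * ρ (i, j) (k, l) * v k

/-- The off-diagonal block `𝓜` of `ρ` in Alice's measurement basis `|+n⟩, |-n⟩`. -/
def offDiag (ρ : Op2) (ξ τ : ℝ) : Op1 := aliceBlock ρ (ketPlus ξ τ) (ketMinus ξ τ)

/-- The decomposition of `ρ` along Alice's measurement basis; it shows that `offDiag` is the
block that multiplies `|+n⟩⟨-n|`, the diagonal blocks being Bob's conditional states. -/
theorem decomposition (ρ : Op2) (hρ : ρ.IsHermitian) (ξ τ : ℝ) :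
    ρ = ketbra (ketPlus ξ τ) (ketPlus ξ τ) ⊗ₖ aliceBlock ρ (ketPlus ξ τ) (ketPlus ξ τ) +
      ketbra (ketMinus ξ τ) (ketMinus ξ τ) ⊗ₖ aliceBlock ρ (ketMinus ξ τ) (ketMinus ξ τ) +
      ketbra (ketPlus ξ τ) (ketMinus ξ τ) ⊗ₖ offDiag ρ ξ τ +
      ketbra (ketMinus ξ τ) (ketPlus ξ τ) ⊗ₖ (offDiag ρ ξ τ)ᴴ := by
  have hadj : (offDiag ρ ξ τ)ᴴ = aliceBlock ρ (ketMinus ξ τ) (ketPlus ξ τ) := by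
    ext j l
    have h : ∀ a b, star (ρ a b) = ρ b a := fun a b => hρ.apply b a
    simp only [Matrix.conjTranspose_apply, offDiag, aliceBlock, Matrix.of_apply,
      Fin.sum_univ_two, star_add, StarMul.star_mul, star_star, h]
    ring
  have hcomp : ∀ i k, ketPlus ξ τ i * star (ketPlus ξ τ k) + ketMinus ξ τ i * star (ketMinus ξ τ k)
      = if i = k then 1 else 0 := by
    have he : Complex.exp (Complex.I * τ) * (starRingEnd ℂ) (Complex.exp (Complex.I * τ)) = 1 := by
      rw [← Complex.exp_conj, ← Complex.exp_add]; simp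
    have hc : (Real.cos (ξ / 2) : ℂ) ^ 2 + (Real.sin (ξ / 2) : ℂ) ^ 2 = 1 := by
      exact_mod_cast Real.cos_sq_add_sin_sq (ξ / 2)
    intro i k
    fin_cases i <;> fin_cases k <;>
      simp [ketPlus, ketMinus, -Complex.ofReal_cos, -Complex.ofReal_sin]
    · linear_combination hc
    · ring
    · ring
    · linear_combination ((Real.cos (ξ / 2) : ℂ) ^ 2 + (Real.sin (ξ / 2) : ℂ) ^ 2) * he + hc
  rw [hadj]
  ext ⟨i, j⟩ ⟨k, l⟩
  simp only [Matrix.add_apply, Matrix.kroneckerMap_apply, ketbra, Matrix.vecMulVec_apply,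
    Pi.star_apply, offDiag, aliceBlock, Matrix.of_apply]
  have key : ∀ P Q : Fin 2 → ℂ,
      P i * star (P k) * (∑ a, ∑ b, star (P a) * ρ (a, j) (b, l) * P b) +
      Q i * star (Q k) * (∑ a, ∑ b, star (Q a) * ρ (a, j) (b, l) * Q b) +
      P i * star (Q k) * (∑ a, ∑ b, star (P a) * ρ (a, j) (b, l) * Q b) +
      Q i * star (P k) * (∑ a, ∑ b, star (Q a) * ρ (a, j) (b, l) * P b) =
      ∑ a, ∑ b, (P i * star (P a) + Q i * star (Q a)) * ρ (a, j) (b, l) *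
        (P b * star (P k) + Q b * star (Q k)) := by
    intro P Q
    simp only [Fin.sum_univ_two]
    ring
  rw [key]
  simp only [hcomp]
  simp

end TwoQubit

end

noncomputable section

namespace TwoQubit

open ComplexConjugate

/-! A two-qubit vector is a product exactly when the determinant of its coefficient matrix vanishes.
On the range of a rank-two state this determinant is a binary quadratic form, with symmetric matrix
`!![a, h; h, c]` in the eigenvectors, so separability becomes a question about its zeros.

Sufficiency: let the eigenvectors carry the square roots of their weights. If `|a| = |c|` and `a h̄
+ h c̄ = 0`, the form vanishes on an orthonormal basis of `ℂ²` (`exists_orthonormal_isotropic`).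
Mixing the weighted eigenvectors by this basis leaves the state unchanged and writes it as two
product projectors.

Necessity: a separable state is a sum of projectors onto product vectors `x_k e + y_k f` in its
range. Each satisfies `(a x_k + h y_k)² = -(ac - h²) y_k²`. Taking moduli and summing over `k`
leaves only the weights, which gives `IsSeparable.coeffDet_eq`.

The bridge to `𝓜` is that its Hermiticity does not involve `ξ` and amounts to three phase equations
in `τ` and `β`. These imply the sufficient condition throughout the parameter range. Conversely, the
necessary identities force equality in a triangle inequality, which fixes the phase of `coeffDet ψ₂`
and provides `τ`, provided `coeffDetPolar ψ₁ ψ₂ ≠ 0`. That quantity is zero at `θ = π/4`, hence the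
restriction there; `sin φ = 0` and `cos φ = 0` need no phase information.

The normal form comes from a singular value decomposition of one eigenvector. If that eigenvector is
maximally entangled the other takes its place; if both are, one coefficient matrix becomes a
multiple of the identity and the other a multiple of a traceless unitary, which can be diagonalized.
-/

/-! ### Product vectors and separable sums of projectors -/

/-- The product vector `u ⊗ v`. -/
def prodVec (u v : Fin 2 → ℂ) : Fin 2 × Fin 2 → ℂ := fun i => u i.1 * v i.2

/-- The determinant of the coefficient matrix of a two-qubit vector. -/
def coeffDet (w : Fin 2 × Fin 2 → ℂ) : ℂ := w (0, 0) * w (1, 1) - w (0, 1) * w (1, 0)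

/-- The symmetric bilinear form whose quadratic form is `coeffDet`. -/
def coeffDetPolar (v w : Fin 2 × Fin 2 → ℂ) : ℂ :=
  (v (0, 0) * w (1, 1) + w (0, 0) * v (1, 1) - v (0, 1) * w (1, 0) - w (0, 1) * v (1, 0)) / 2

theorem ketbra_apply {ι : Type} (u v : ι → ℂ) (i j : ι) : ketbra u v i j = u i * star (v j) := rfl

theorem ketbra_prodVec (u v : Fin 2 → ℂ) :
    ketbra (prodVec u v) (prodVec u v) = ketbra u u ⊗ₖ ketbra v v := by
  ext ⟨i, j⟩ ⟨k, l⟩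
  simp only [ketbra_apply, prodVec, Matrix.kroneckerMap_apply, star_mul]
  ring

theorem coeffDet_prodVec (u v : Fin 2 → ℂ) : coeffDet (prodVec u v) = 0 := by
  simp only [coeffDet, prodVec]; ring

theorem coeffDet_smul_add_smul (x y : ℂ) (v w : Fin 2 × Fin 2 → ℂ) :
    coeffDet (x • v + y • w) =
      coeffDet v * x ^ 2 + 2 * coeffDetPolar v w * x * y + coeffDet w * y ^ 2 := by
  simp only [coeffDet, coeffDetPolar, Pi.add_apply, Pi.smul_apply, smul_eq_mul]; ring

theorem coeffDet_smul (x : ℂ) (v : Fin 2 × Fin 2 → ℂ) : coeffDet (x • v) = x ^ 2 * coeffDet v := by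
  simp only [coeffDet, Pi.smul_apply, smul_eq_mul]; ring

theorem coeffDetPolar_smul_smul (x y : ℂ) (v w : Fin 2 × Fin 2 → ℂ) :
    coeffDetPolar (x • v) (y • w) = x * y * coeffDetPolar v w := by
  simp only [coeffDetPolar, Pi.smul_apply, smul_eq_mul]; ring

theorem exists_eq_prodVec {w : Fin 2 × Fin 2 → ℂ} (h : coeffDet w = 0) :
    ∃ u v, w = prodVec u v := by
  have h' : w (0, 0) * w (1, 1) = w (0, 1) * w (1, 0) := sub_eq_zero.1 h
  by_cases h00 : w (0, 0) = 0
  · by_cases h01 : w (0, 1) = 0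
    · refine ⟨![0, 1], ![w (1, 0), w (1, 1)], ?_⟩
      ext ⟨i, j⟩
      fin_cases i <;> fin_cases j <;> simp [prodVec, h00, h01]
    · have h10 : w (1, 0) = 0 := by simpa [h00, h01] using h'.symm
      refine ⟨![w (0, 1), w (1, 1)], ![0, 1], ?_⟩
      ext ⟨i, j⟩
      fin_cases i <;> fin_cases j <;> simp [prodVec, h00, h10]
  · refine ⟨![w (0, 0), w (1, 0)], ![1, w (0, 1) / w (0, 0)], ?_⟩
    ext ⟨i, j⟩
    fin_cases i <;> fin_cases j <;> simp [prodVec]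
    · field_simp
    · field_simp
      linear_combination h'

theorem ketbra_trace {ι : Type} [Fintype ι] (u : ι → ℂ) :
    (ketbra u u).trace = ((∑ i, ‖u i‖ ^ 2 : ℝ) : ℂ) := by
  simp only [Matrix.trace, Matrix.diag_apply, ketbra_apply, Complex.ofReal_sum]
  refine Finset.sum_congr rfl fun i _ => ?_
  rw [Complex.star_def, Complex.mul_conj, Complex.normSq_eq_norm_sq]

theorem exists_isDensity_smul_eq_ketbra (u : Fin 2 → ℂ) :
    ∃ (A : Op1) (t : ℝ), IsDensity A ∧ 0 ≤ t ∧ ketbra u u = t • A := by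
  set s : ℝ := ∑ i, ‖u i‖ ^ 2 with hs
  have hs0 : 0 ≤ s := Finset.sum_nonneg fun i _ => by positivity
  by_cases h : s = 0
  · refine ⟨ketbra (Pi.single 0 1) (Pi.single 0 1), 0,
      ⟨Matrix.posSemidef_vecMulVec_self_star _, ?_⟩, le_rfl, ?_⟩
    · rw [ketbra_trace]; simp
    · have hu : u = 0 := by
        ext i
        have := (Finset.sum_eq_zero_iff_of_nonneg
          (fun i _ => by positivity : ∀ i ∈ Finset.univ, 0 ≤ ‖u i‖ ^ 2)).1 (hs ▸ h) i (by simp)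
        simpa using this
      ext i j
      simp [ketbra_apply, hu]
  · refine ⟨s⁻¹ • ketbra u u, s,
      ⟨(Matrix.posSemidef_vecMulVec_self_star u).smul (inv_nonneg.2 hs0), ?_⟩, hs0, ?_⟩
    · rw [Matrix.trace_smul, ketbra_trace, ← hs, Complex.real_smul, ← Complex.ofReal_mul,
        inv_mul_cancel₀ h, Complex.ofReal_one]
    · rw [smul_smul, mul_inv_cancel₀ h, one_smul]

theorem exists_smul_kronecker_eq_ketbra {w : Fin 2 × Fin 2 → ℂ} (h : coeffDet w = 0) :
    ∃ (A B : Op1) (t : ℝ), IsDensity A ∧ IsDensity B ∧ 0 ≤ t ∧ ketbra w w = t • (A ⊗ₖ B) := by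
  obtain ⟨u, v, rfl⟩ := exists_eq_prodVec h
  obtain ⟨A, s, hA, hs, hu⟩ := exists_isDensity_smul_eq_ketbra u
  obtain ⟨B, t, hB, ht, hv⟩ := exists_isDensity_smul_eq_ketbra v
  refine ⟨A, B, s * t, hA, hB, mul_nonneg hs ht, ?_⟩
  rw [ketbra_prodVec, hu, hv, Matrix.smul_kronecker, Matrix.kronecker_smul, smul_smul]

/-- A normalized sum of two projectors onto product vectors is separable. -/
theorem isSeparable_ketbra_add_ketbra {v w : Fin 2 × Fin 2 → ℂ} (hv : coeffDet v = 0)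
    (hw : coeffDet w = 0) (htr : (ketbra v v + ketbra w w).trace = 1) :
    IsSeparable (ketbra v v + ketbra w w) := by
  obtain ⟨A, B, s, hA, hB, hs, h₁⟩ := exists_smul_kronecker_eq_ketbra hv
  obtain ⟨C, D, t, hC, hD, ht, h₂⟩ := exists_smul_kronecker_eq_ketbra hw
  rw [h₁, h₂] at htr ⊢
  rw [Matrix.trace_add, Matrix.trace_smul, Matrix.trace_smul, Matrix.trace_kronecker,
    Matrix.trace_kronecker, hA.2, hB.2, hC.2, hD.2] at htr
  have hst : s + t = 1 := by
    have : ((s + t : ℝ) : ℂ) = 1 := by simpa using htr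
    exact_mod_cast this
  exact convex_convexHull ℝ {σ : Op2 | ∃ A B : Op1, IsDensity A ∧ IsDensity B ∧ σ = A ⊗ₖ B}
    (subset_convexHull ℝ _ ⟨A, B, hA, hB, rfl⟩)
    (subset_convexHull ℝ _ ⟨C, D, hC, hD, rfl⟩) hs ht hst

theorem ketbra_sqrt_smul {ι : Type} {c : ℝ} (hc : 0 ≤ c) (z : ι → ℂ) :
    ketbra (((√c : ℝ) : ℂ) • z) (((√c : ℝ) : ℂ) • z) = c • ketbra z z := by
  ext i j
  have : ((√c : ℝ) : ℂ) * ((√c : ℝ) : ℂ) = c := by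
    rw [← Complex.ofReal_mul, Real.mul_self_sqrt hc]
  simp only [ketbra_apply, Pi.smul_apply, smul_eq_mul, star_mul, Complex.star_def,
    Complex.conj_ofReal, Matrix.smul_apply, Complex.real_smul, ← this]
  ring

/-- A separable state is a finite sum of projectors onto (unnormalized) product vectors. -/
theorem IsSeparable.exists_sum_ketbra {ρ : Op2} (h : IsSeparable ρ) :
    ∃ (ι : Type) (_ : Fintype ι) (w : ι → Fin 2 × Fin 2 → ℂ),
      (∀ k, coeffDet (w k) = 0) ∧ ρ = ∑ k, ketbra (w k) (w k) := by
  refine convexHull_min (t := {ρ : Op2 | ∃ (ι : Type) (_ : Fintype ι)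
    (w : ι → Fin 2 × Fin 2 → ℂ), (∀ k, coeffDet (w k) = 0) ∧ ρ = ∑ k, ketbra (w k) (w k)})
    ?_ ?_ h
  · rintro _ ⟨A, B, hA, hB, rfl⟩
    obtain ⟨m, x, hx⟩ := Matrix.posSemidef_iff_eq_sum_vecMulVec.1 hA.1
    obtain ⟨n, y, hy⟩ := Matrix.posSemidef_iff_eq_sum_vecMulVec.1 hB.1
    refine ⟨Fin m × Fin n, inferInstance, fun k => prodVec (x k.1) (y k.2),
      fun k => coeffDet_prodVec _ _, ?_⟩
    ext ⟨i, j⟩ ⟨k, l⟩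
    simp only [hx, hy, ketbra_prodVec, Matrix.sum_apply, Matrix.kroneckerMap_apply,
      Fintype.sum_prod_type, Finset.sum_mul_sum]
    rfl
  · rintro _ ⟨ι, _, v, hv, rfl⟩ _ ⟨κ, _, w, hw, rfl⟩ a b ha hb -
    refine ⟨ι ⊕ κ, inferInstance, Sum.elim (fun k => ((√a : ℝ) : ℂ) • v k)
      (fun k => ((√b : ℝ) : ℂ) • w k), ?_, ?_⟩
    · rintro (k | k)
      · rw [Sum.elim_inl, coeffDet_smul, hv, mul_zero]
      · rw [Sum.elim_inr, coeffDet_smul, hw, mul_zero]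
    · simp only [Fintype.sum_sum_type, Sum.elim_inl, Sum.elim_inr, ketbra_sqrt_smul ha,
        ketbra_sqrt_smul hb, Finset.smul_sum]

theorem IsSeparable.conj_kronecker {ρ : Op2} (h : IsSeparable ρ) {U V : Op1}
    (hU : U ∈ Matrix.unitaryGroup (Fin 2) ℂ) (hV : V ∈ Matrix.unitaryGroup (Fin 2) ℂ) :
    IsSeparable ((U ⊗ₖ V) * ρ * (U ⊗ₖ V)ᴴ) := by
  have hden : ∀ {W A : Op1}, W ∈ Matrix.unitaryGroup (Fin 2) ℂ → IsDensity A →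
      IsDensity (W * A * Wᴴ) := fun {W A} hW hA =>
    ⟨hA.1.mul_mul_conjTranspose_same W, by
      rw [Matrix.trace_mul_comm, ← Matrix.mul_assoc, ← Matrix.star_eq_conjTranspose,
        Matrix.mem_unitaryGroup_iff'.1 hW, Matrix.one_mul, hA.2]⟩
  let f : Op2 →ₗ[ℝ] Op2 :=
    (LinearMap.mulRight ℝ (U ⊗ₖ V)ᴴ).comp (LinearMap.mulLeft ℝ (U ⊗ₖ V))
  have : f ρ ∈ f '' convexHull ℝ _ := Set.mem_image_of_mem f h
  rw [f.image_convexHull] at this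
  refine convexHull_mono ?_ this
  rintro _ ⟨_, ⟨A, B, hA, hB, rfl⟩, rfl⟩
  refine ⟨_, _, hden hU hA, hden hV hB, ?_⟩
  simp only [f, LinearMap.comp_apply, LinearMap.mulLeft_apply, LinearMap.mulRight_apply,
    Matrix.conjTranspose_kronecker, Matrix.mul_kronecker_mul]

theorem isSeparable_conj_kronecker_iff {ρ : Op2} {U V : Op1}
    (hU : U ∈ Matrix.unitaryGroup (Fin 2) ℂ) (hV : V ∈ Matrix.unitaryGroup (Fin 2) ℂ) :
    IsSeparable ((U ⊗ₖ V) * ρ * (U ⊗ₖ V)ᴴ) ↔ IsSeparable ρ := by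
  refine ⟨fun h => ?_, fun h => h.conj_kronecker hU hV⟩
  have h1 := h.conj_kronecker (Unitary.star_mem hU) (Unitary.star_mem hV)
  have h2 : (star U ⊗ₖ star V) * (U ⊗ₖ V) = 1 := by
    rw [← Matrix.mul_kronecker_mul, Matrix.mem_unitaryGroup_iff'.1 hU,
      Matrix.mem_unitaryGroup_iff'.1 hV, Matrix.one_kronecker_one]
  have h3 : (U ⊗ₖ V)ᴴ * (star U ⊗ₖ star V)ᴴ = 1 := by
    rw [← Matrix.conjTranspose_mul, h2, Matrix.conjTranspose_one]
  have h4 : (star U ⊗ₖ star V) * ((U ⊗ₖ V) * ρ * (U ⊗ₖ V)ᴴ) * (star U ⊗ₖ star V)ᴴ = ρ := by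
    calc _ = ((star U ⊗ₖ star V) * (U ⊗ₖ V)) * ρ * ((U ⊗ₖ V)ᴴ * (star U ⊗ₖ star V)ᴴ) := by
          simp only [Matrix.mul_assoc]
      _ = ρ := by rw [h2, h3, Matrix.one_mul, Matrix.mul_one]
  rwa [h4] at h1

/-! ### Separability criteria from the determinant form -/

/-- If the symmetric matrix `!![a, h; h, c]` is a multiple of a unitary one, then its quadratic form
vanishes on an orthonormal basis `(x, y)`, `(-conj y, conj x)`. -/
theorem exists_orthonormal_isotropic {a h c : ℂ} (hac : ‖a‖ = ‖c‖)
    (hh : a * conj h + h * conj c = 0) :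
    ∃ x y : ℂ, x * conj x + y * conj y = 1 ∧ a * x ^ 2 + 2 * h * x * y + c * y ^ 2 = 0 ∧
      a * (-conj y) ^ 2 + 2 * h * (-conj y) * conj x + c * conj x ^ 2 = 0 := by
  have hac' : a * conj a = c * conj c := by
    rw [Complex.mul_conj, Complex.mul_conj, Complex.normSq_eq_norm_sq, Complex.normSq_eq_norm_sq,
      hac]
  have hroot : ∃ x y : ℂ, x * conj x + y * conj y = 1 ∧
      a * x ^ 2 + 2 * h * x * y + c * y ^ 2 = 0 := by
    by_cases ha : a = 0
    · exact ⟨1, 0, by simp, by simp [ha]⟩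
    · obtain ⟨s, hs⟩ := IsAlgClosed.exists_pow_nat_eq (discrim a (2 * h) c) (n := 2) (by norm_num)
      obtain ⟨z, hz⟩ := exists_quadratic_eq_zero ha ⟨s, by rw [← hs, sq]⟩
      have hpos : (0 : ℝ) < ‖z‖ ^ 2 + 1 := by positivity
      set n : ℝ := (√(‖z‖ ^ 2 + 1))⁻¹ with hn
      have hn2 : (n : ℂ) * n * (z * conj z + 1) = 1 := by
        rw [Complex.mul_conj, Complex.normSq_eq_norm_sq]
        have : n * n * (‖z‖ ^ 2 + 1) = 1 := by
          rw [hn, ← mul_inv, Real.mul_self_sqrt hpos.le, inv_mul_cancel₀ hpos.ne']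
        exact_mod_cast this
      refine ⟨n * z, n, ?_, ?_⟩
      · simp only [map_mul, Complex.conj_ofReal]
        linear_combination hn2
      · linear_combination (n : ℂ) ^ 2 * hz
  obtain ⟨x, y, hxy, hq⟩ := hroot
  refine ⟨x, y, hxy, hq, ?_⟩
  -- The conjugate of the form at `(-ȳ, x̄)` is a multiple of its value at `(x, y)`: multiplied by
  -- `h` it equals `-h̄` times that value. For `h = 0` the multiplier `a` serves instead, with
  -- factor `c̄`.
  have hconj : conj a * y ^ 2 - 2 * conj h * x * y + conj c * x ^ 2 = 0 := by
    by_cases h0 : h = 0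
    · subst h0
      by_cases ha : a = 0
      · have hc : c = 0 := by simpa [ha] using hac.symm
        simp [ha, hc]
      · apply (mul_eq_zero.1 (_ : a * _ = 0)).resolve_left ha
        linear_combination y ^ 2 * hac' + conj c * hq - 2 * a * x * y * map_zero (starRingEnd ℂ)
    · apply (mul_eq_zero.1 (_ : h * _ = 0)).resolve_left h0
      have hh' : conj a * h + conj h * c = 0 := by
        simpa using congrArg conj hh
      linear_combination y ^ 2 * hh' + x ^ 2 * hh - conj h * hq
  have := congrArg conj hconj
  simp only [map_add, map_sub, map_mul, map_pow, Complex.conj_conj, map_ofNat, map_zero] at this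
  linear_combination this

/-- Sufficient condition for the separability of a state of rank at most two. -/
theorem isSeparable_of_coeffDet {v w : Fin 2 × Fin 2 → ℂ}
    (htr : (ketbra v v + ketbra w w).trace = 1) (hvw : ‖coeffDet v‖ = ‖coeffDet w‖)
    (hpol : coeffDet v * conj (coeffDetPolar v w) + coeffDetPolar v w * conj (coeffDet w) = 0) :
    IsSeparable (ketbra v v + ketbra w w) := by
  obtain ⟨x, y, hxy, h₁, h₂⟩ := exists_orthonormal_isotropic hvw hpol
  -- Unitary freedom of ensembles: mixing the two vectors by a unitary matrix preserves the sum of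
  -- their projectors.
  have heq : ketbra v v + ketbra w w = ketbra (x • v + y • w) (x • v + y • w) +
      ketbra ((-conj y) • v + conj x • w) ((-conj y) • v + conj x • w) := by
    ext i j
    simp only [Matrix.add_apply, ketbra_apply, Pi.add_apply, Pi.smul_apply, smul_eq_mul, star_add,
      star_mul, star_neg, Complex.star_def, Complex.conj_conj]
    linear_combination (-v i * conj (v j) - w i * conj (w j)) * hxy
  rw [heq] at htr ⊢
  exact isSeparable_ketbra_add_ketbra (by rw [coeffDet_smul_add_smul, h₁])
    (by rw [coeffDet_smul_add_smul, h₂]) htr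

theorem star_dotProduct_ketbra_mulVec {ι : Type} [Fintype ι] (u v w : ι → ℂ) :
    star u ⬝ᵥ (ketbra w w *ᵥ v) = (star u ⬝ᵥ w) * star (star v ⬝ᵥ w) := by
  rw [ketbra, Matrix.vecMulVec_mulVec, ← Matrix.star_dotProduct]
  simp [mul_comm]

/-- Necessary condition for the separability of a state of rank at most two. -/
theorem IsSeparable.coeffDet_eq {e f : Fin 2 × Fin 2 → ℂ} {p q : ℝ}
    (hee : star e ⬝ᵥ e = 1) (hff : star f ⬝ᵥ f = 1) (hef : star e ⬝ᵥ f = 0) (hpq : p + q = 1)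
    (hsep : IsSeparable ((p : ℂ) • ketbra e e + (q : ℂ) • ketbra f f)) :
    p * ‖coeffDet e‖ ^ 2 + q * ‖coeffDetPolar e f‖ ^ 2 =
        q * ‖coeffDet e * coeffDet f - coeffDetPolar e f ^ 2‖ ∧
      p * ‖coeffDetPolar e f‖ ^ 2 + q * ‖coeffDet f‖ ^ 2 =
        p * ‖coeffDet e * coeffDet f - coeffDetPolar e f ^ 2‖ := by
  obtain ⟨ι, _, w, hw, hρ⟩ := hsep.exists_sum_ketbra
  have hfe : star f ⬝ᵥ e = 0 := by
    rw [Matrix.star_dotProduct, hef, star_zero]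
  set x : ι → ℂ := fun k => star e ⬝ᵥ w k with hx
  set y : ι → ℂ := fun k => star f ⬝ᵥ w k with hy
  have hsum : ∀ u v : Fin 2 × Fin 2 → ℂ, ∑ k, (star u ⬝ᵥ w k) * star (star v ⬝ᵥ w k) =
      p * ((star u ⬝ᵥ e) * star (star v ⬝ᵥ e)) + q * ((star u ⬝ᵥ f) * star (star v ⬝ᵥ f)) := by
    intro u v
    have := congrArg (fun M : Op2 => star u ⬝ᵥ (M *ᵥ v)) hρ
    simp only [Matrix.add_mulVec, Matrix.smul_mulVec, dotProduct_add, dotProduct_smul,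
      Matrix.sum_mulVec, dotProduct_sum, star_dotProduct_ketbra_mulVec, smul_eq_mul] at this
    exact this.symm
  have hxx : ∑ k, x k * conj (x k) = p := by simpa [hee, hef] using hsum e e
  have hyy : ∑ k, y k * conj (y k) = q := by simpa [hff, hfe] using hsum f f
  have hxy : ∑ k, x k * conj (y k) = 0 := by simpa [hef, hfe] using hsum e f
  have hyx : ∑ k, y k * conj (x k) = 0 := by simpa [hef, hfe] using hsum f e
  have hnorm : ∑ k, star (w k) ⬝ᵥ w k = 1 := by
    have := congrArg Matrix.trace hρ
    simp only [Matrix.trace_add, Matrix.trace_smul, Matrix.trace_sum, ketbra,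
      Matrix.trace_vecMulVec] at this
    simp only [dotProduct_comm _ (star _)] at this
    rw [← this, hee, hff]
    simp only [smul_eq_mul, mul_one]
    exact_mod_cast hpq
  have hr : ∀ k, star (w k - x k • e - y k • f) ⬝ᵥ (w k - x k • e - y k • f) =
      star (w k) ⬝ᵥ w k - x k * conj (x k) - y k * conj (y k) := by
    intro k
    have h1 : star (w k) ⬝ᵥ e = conj (x k) := by rw [Matrix.star_dotProduct]; rfl
    have h2 : star (w k) ⬝ᵥ f = conj (y k) := by rw [Matrix.star_dotProduct]; rfl
    have h3 : star e ⬝ᵥ w k = x k := rfl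
    have h4 : star f ⬝ᵥ w k = y k := rfl
    simp only [star_sub, star_smul, sub_dotProduct, dotProduct_sub, smul_dotProduct,
      dotProduct_smul, smul_eq_mul, hee, hff, hef, hfe, h1, h2, h3, h4, Complex.star_def]
    ring
  -- The squared norms of the components orthogonal to `e` and `f` sum to the trace minus `p + q`,
  -- which is zero, so each component vanishes.
  have hw' : ∀ k, w k = x k • e + y k • f := by
    have h0 : ∑ k, star (w k - x k • e - y k • f) ⬝ᵥ (w k - x k • e - y k • f) = 0 := by
      simp only [hr, Finset.sum_sub_distrib, hxx, hyy, hnorm]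
      rw [← Complex.ofReal_one, ← hpq]; push_cast; ring
    intro k
    have := (Finset.sum_eq_zero_iff_of_nonneg
      (fun k _ => dotProduct_star_self_nonneg _)).1 h0 k (Finset.mem_univ k)
    rw [dotProduct_star_self_eq_zero] at this
    rw [sub_sub, sub_eq_zero] at this
    exact this
  have hq : ∀ k, coeffDet e * x k ^ 2 + 2 * coeffDetPolar e f * x k * y k +
      coeffDet f * y k ^ 2 = 0 := by
    intro k
    rw [← coeffDet_smul_add_smul, ← hw', hw]
  generalize coeffDet e = a at *
  generalize coeffDet f = c at *
  generalize coeffDetPolar e f = h at *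
  -- Applied below to the completed squares `(a x + h y)² = -(ac - h²) y²` and `(h x + c y)² = -(ac
  -- - h²) x²`.
  have hsq : ∀ s t : ℂ, s ^ 2 = -(a * c - h ^ 2) * t ^ 2 →
      s * conj s = (‖a * c - h ^ 2‖ : ℂ) * (t * conj t) := by
    intro s t hst
    have := congrArg norm hst
    rw [norm_mul, norm_neg, norm_pow, norm_pow] at this
    rw [Complex.mul_conj, Complex.mul_conj, Complex.normSq_eq_norm_sq, Complex.normSq_eq_norm_sq,
      this]
    push_cast; rfl
  have key : ∀ s t : ℂ, ∑ k, (s * x k + t * y k) * conj (s * x k + t * y k) =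
      p * ‖s‖ ^ 2 + q * ‖t‖ ^ 2 := by
    intro s t
    have : ∀ k, (s * x k + t * y k) * conj (s * x k + t * y k) =
        s * conj s * (x k * conj (x k)) + t * conj t * (y k * conj (y k)) +
        s * conj t * (x k * conj (y k)) + t * conj s * (y k * conj (x k)) := by
      intro k; simp only [map_add, map_mul]; ring
    simp only [this, Finset.sum_add_distrib, ← Finset.mul_sum, hxx, hyy, hxy, hyx]
    rw [Complex.mul_conj, Complex.mul_conj, Complex.normSq_eq_norm_sq, Complex.normSq_eq_norm_sq]
    push_cast; ring
  have k1 := key a h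
  have k2 := key h c
  simp only [fun k => hsq (a * x k + h * y k) (y k) (by linear_combination a * hq k),
    ← Finset.mul_sum, hyy] at k1
  simp only [fun k => hsq (h * x k + c * y k) (x k) (by linear_combination c * hq k),
    ← Finset.mul_sum, hxx] at k2
  constructor
  · have : p * ‖a‖ ^ 2 + q * ‖h‖ ^ 2 = ‖a * c - h ^ 2‖ * q := by exact_mod_cast k1.symm
    linarith
  · have : p * ‖h‖ ^ 2 + q * ‖c‖ ^ 2 = ‖a * c - h ^ 2‖ * p := by exact_mod_cast k2.symm
    linarith

/-! ### Hermiticity of the off-diagonal block in the parameters -/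

theorem exp_I_mul_conj (t : ℝ) :
    Complex.exp (Complex.I * t) * (starRingEnd ℂ) (Complex.exp (Complex.I * t)) = 1 := by
  rw [← Complex.exp_conj, ← Complex.exp_add]; simp

/-- Whether the off-diagonal block is Hermitian does not depend on `ξ`. -/
theorem offDiag_isHermitian_iff {ρ : Op2} (hρ : ρ.IsHermitian) (ξ τ : ℝ) :
    (offDiag ρ ξ τ).IsHermitian ↔ ∀ j l, Complex.exp (Complex.I * τ) * ρ (0, j) (1, l) =
      conj (Complex.exp (Complex.I * τ) * ρ (0, l) (1, j)) := by
  -- `|-n⟩⟨+n| - |+n⟩⟨-n|` is `i` times a spin operator along the horizontal direction orthogonal to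
  -- `n`, which depends on `τ` alone; `ξ` enters only through `cos² + sin² = 1`.
  have hsub : ∀ j l, (offDiag ρ ξ τ)ᴴ j l - offDiag ρ ξ τ j l =
      Complex.exp (Complex.I * τ) * ρ (0, j) (1, l) -
        conj (Complex.exp (Complex.I * τ) * ρ (0, l) (1, j)) := by
    intro j l
    have h : ∀ a b, conj (ρ a b) = ρ b a := fun a b => hρ.apply b a
    have he := exp_I_mul_conj τ
    have hc : (Real.cos (ξ / 2) : ℂ) ^ 2 + (Real.sin (ξ / 2) : ℂ) ^ 2 = 1 := by
      exact_mod_cast Real.cos_sq_add_sin_sq (ξ / 2)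
    simp only [Matrix.conjTranspose_apply, offDiag, aliceBlock, Matrix.of_apply,
      Fin.sum_univ_two, star_add, StarMul.star_mul, Complex.star_def, h, ketPlus,
      ketMinus, Matrix.cons_val_zero, Matrix.cons_val_one, map_mul, map_neg, Complex.conj_ofReal,
      Complex.conj_conj]
    linear_combination (Complex.exp (Complex.I * τ) * ρ (0, j) (1, l) -
      conj (Complex.exp (Complex.I * τ)) * ρ (1, j) (0, l)) * hc
  rw [Matrix.IsHermitian, ← Matrix.ext_iff]
  exact forall₂_congr fun j l => by rw [← sub_eq_zero, hsub, sub_eq_zero]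

namespace Params

theorem ψ₁_apply (p : Params) :
    p.ψ₁ (0, 0) = Real.cos p.θ ∧ p.ψ₁ (0, 1) = 0 ∧ p.ψ₁ (1, 0) = 0 ∧
      p.ψ₁ (1, 1) = Real.sin p.θ := by
  simp [ψ₁, ket, -Complex.ofReal_cos, -Complex.ofReal_sin]

theorem ψ₂_apply (p : Params) :
    p.ψ₂ (0, 0) = Complex.exp (Complex.I * p.β) * Real.sin p.φ * Real.sin p.θ ∧
      p.ψ₂ (0, 1) = Real.cos p.φ * Real.cos p.α ∧ p.ψ₂ (1, 0) = Real.cos p.φ * Real.sin p.α ∧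
      p.ψ₂ (1, 1) = -(Complex.exp (Complex.I * p.β) * Real.sin p.φ * Real.cos p.θ) := by
  simp [ψ₂, ket, -Complex.ofReal_cos, -Complex.ofReal_sin]

theorem state_isHermitian (p : Params) : p.state.IsHermitian := by
  ext i j
  simp only [Matrix.conjTranspose_apply, state, Matrix.add_apply, Matrix.smul_apply, ketbra_apply,
    smul_eq_mul, star_add, star_mul, Complex.star_def, Complex.conj_ofReal,
    Complex.conj_conj]
  ring

theorem ψ₁_normalized (p : Params) : star p.ψ₁ ⬝ᵥ p.ψ₁ = 1 := by
  obtain ⟨h1, h2, h3, h4⟩ := p.ψ₁_apply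
  simp only [dotProduct, Fintype.sum_prod_type, Fin.sum_univ_two, Pi.star_apply, h1, h2, h3, h4,
    Complex.star_def, Complex.conj_ofReal]
  have : (Real.cos p.θ : ℂ) ^ 2 + (Real.sin p.θ : ℂ) ^ 2 = 1 := by
    exact_mod_cast Real.cos_sq_add_sin_sq _
  linear_combination this

theorem ψ₂_normalized (p : Params) : star p.ψ₂ ⬝ᵥ p.ψ₂ = 1 := by
  obtain ⟨h1, h2, h3, h4⟩ := p.ψ₂_apply
  simp only [dotProduct, Fintype.sum_prod_type, Fin.sum_univ_two, Pi.star_apply, h1, h2, h3, h4,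
    Complex.star_def, map_mul, map_neg, Complex.conj_ofReal]
  have hsq : ∀ t : ℝ, (Real.cos t : ℂ) ^ 2 + (Real.sin t : ℂ) ^ 2 = 1 := fun t => by
    exact_mod_cast Real.cos_sq_add_sin_sq _
  linear_combination (Real.sin p.φ : ℂ) ^ 2 * ((Real.cos p.θ : ℂ) ^ 2 + (Real.sin p.θ : ℂ) ^ 2) *
    exp_I_mul_conj p.β + (Real.sin p.φ : ℂ) ^ 2 * hsq p.θ + (Real.cos p.φ : ℂ) ^ 2 * hsq p.α +
    hsq p.φ

theorem ψ₁_orthogonal_ψ₂ (p : Params) : star p.ψ₁ ⬝ᵥ p.ψ₂ = 0 := by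
  obtain ⟨h1, h2, h3, h4⟩ := p.ψ₁_apply
  obtain ⟨k1, k2, k3, k4⟩ := p.ψ₂_apply
  simp only [dotProduct, Fintype.sum_prod_type, Fin.sum_univ_two, Pi.star_apply, h1, h2, h3, h4,
    k1, k2, k3, k4, Complex.star_def, Complex.conj_ofReal, map_zero]
  ring

theorem coeffDet_ψ₁ (p : Params) : coeffDet p.ψ₁ = (Real.sin p.θ * Real.cos p.θ : ℝ) := by
  obtain ⟨h1, h2, h3, h4⟩ := p.ψ₁_apply
  simp only [coeffDet, h1, h2, h3, h4]
  push_cast; ring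

theorem coeffDet_ψ₂ (p : Params) : coeffDet p.ψ₂ =
    -(Complex.exp (Complex.I * p.β) ^ 2 * (Real.sin p.φ ^ 2 * (Real.sin p.θ * Real.cos p.θ) : ℝ) +
      (Real.cos p.φ ^ 2 * (Real.sin p.α * Real.cos p.α) : ℝ)) := by
  obtain ⟨h1, h2, h3, h4⟩ := p.ψ₂_apply
  simp only [coeffDet, h1, h2, h3, h4]
  push_cast; ring

theorem coeffDetPolar_ψ₁_ψ₂ (p : Params) : coeffDetPolar p.ψ₁ p.ψ₂ =
    Complex.exp (Complex.I * p.β) *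
      (Real.sin p.φ * (Real.sin p.θ ^ 2 - Real.cos p.θ ^ 2) / 2 : ℝ) := by
  obtain ⟨h1, h2, h3, h4⟩ := p.ψ₁_apply
  obtain ⟨k1, k2, k3, k4⟩ := p.ψ₂_apply
  simp only [coeffDetPolar, h1, h2, h3, h4, k1, k2, k3, k4]
  push_cast; ring

/-- The equations are the entries `(0,0)`, `(1,1)` and `(0,1)` of the block condition; the entry
`(1,0)` is conjugate to the last. In the third equation `e^{iβ}` cancels against its conjugate. -/
theorem offDiag_state_isHermitian_iff (p : Params) (ξ τ : ℝ) :
    (offDiag p.state ξ τ).IsHermitian ↔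
      Complex.exp (Complex.I * τ) * Complex.exp (Complex.I * p.β) *
          (p.ν₂ * (Real.sin p.φ * Real.cos p.φ) * (Real.sin p.θ * Real.sin p.α) : ℝ) =
        conj (Complex.exp (Complex.I * τ) * Complex.exp (Complex.I * p.β)) *
          (p.ν₂ * (Real.sin p.φ * Real.cos p.φ) * (Real.sin p.θ * Real.sin p.α) : ℝ) ∧
      Complex.exp (Complex.I * τ) * conj (Complex.exp (Complex.I * p.β)) *
          (p.ν₂ * (Real.sin p.φ * Real.cos p.φ) * (Real.cos p.θ * Real.cos p.α) : ℝ) =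
        conj (Complex.exp (Complex.I * τ)) * Complex.exp (Complex.I * p.β) *
          (p.ν₂ * (Real.sin p.φ * Real.cos p.φ) * (Real.cos p.θ * Real.cos p.α) : ℝ) ∧
      Complex.exp (Complex.I * τ) *
          ((p.ν₁ - p.ν₂ * Real.sin p.φ ^ 2) * (Real.sin p.θ * Real.cos p.θ) : ℝ) =
        conj (Complex.exp (Complex.I * τ)) *
          (p.ν₂ * Real.cos p.φ ^ 2 * (Real.sin p.α * Real.cos p.α) : ℝ) := by
  obtain ⟨h1, h2, h3, h4⟩ := p.ψ₁_apply
  obtain ⟨k1, k2, k3, k4⟩ := p.ψ₂_apply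
  have hF := exp_I_mul_conj p.β
  rw [offDiag_isHermitian_iff p.state_isHermitian]
  simp only [Fin.forall_fin_two, state, Matrix.add_apply, Matrix.smul_apply, ketbra_apply, h1, h2,
    h3, h4, k1, k2, k3, k4, smul_eq_mul, Complex.star_def, map_mul, map_add, map_neg,
    Complex.conj_ofReal, Complex.conj_conj, map_zero]
  generalize Complex.exp (Complex.I * p.β) = F at *
  generalize Complex.exp (Complex.I * τ) = E
  generalize Real.sin p.θ = sθ
  generalize Real.cos p.θ = cθ
  generalize Real.sin p.φ = sφ
  generalize Real.cos p.φ = cφ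
  generalize Real.sin p.α = sα
  generalize Real.cos p.α = cα
  push_cast
  constructor
  · rintro ⟨⟨a1, a2⟩, a3, a4⟩
    refine ⟨?_, ?_, ?_⟩
    · linear_combination a1
    · linear_combination -a4
    · linear_combination a2 + E * p.ν₂ * sφ ^ 2 * sθ * cθ * hF
  · rintro ⟨b1, b2, b3⟩
    have b4 := congrArg conj b3
    simp only [map_mul, map_sub, map_pow, Complex.conj_conj, Complex.conj_ofReal] at b4
    refine ⟨⟨?_, ?_⟩, ?_, ?_⟩
    · linear_combination b1
    · linear_combination b3 - E * p.ν₂ * sφ ^ 2 * sθ * cθ * hF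
    · linear_combination -b4 + conj E * p.ν₂ * sφ ^ 2 * sθ * cθ * hF
    · linear_combination -b2

end Params

/-! ### Equivalence of the phase equations and the determinant criteria -/

/-- Here `E = e^{iτ}`, `F = e^{iβ}`, and `s, c, u, v, z, w` are the sines and cosines of `φ`, `θ`,
`α`. The first conclusion is `|a| = |c|` for the weighted form; the second yields `a h̄ + h c̄ = 0`,
since `h` carries the factor `s`. -/
theorem weighted_coeffDet_of_hermitian {E F : ℂ} (hE : E * conj E = 1) (hF : F * conj F = 1)
    {p q s c u v z w : ℝ} (hp : 0 ≤ p) (hu : 0 ≤ u) (hv : 0 ≤ v)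
    (h₁ : E * F * (q * (s * c) * (u * z) : ℝ) = conj (E * F) * (q * (s * c) * (u * z) : ℝ))
    (h₂ : E * conj F * (q * (s * c) * (v * w) : ℝ) = conj E * F * (q * (s * c) * (v * w) : ℝ))
    (h₃ : E * ((p - q * s ^ 2) * (u * v) : ℝ) = conj E * (q * c ^ 2 * (z * w) : ℝ)) :
    ‖q * (F ^ 2 * (s ^ 2 * (u * v) : ℝ) + (c ^ 2 * (z * w) : ℝ))‖ = p * (u * v) ∧
      (s = 0 ∨ q * (F ^ 2 * (s ^ 2 * (u * v) : ℝ) + (c ^ 2 * (z * w) : ℝ)) =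
        F ^ 2 * (p * (u * v) : ℝ)) := by
  have hE0 : E ≠ 0 := left_ne_zero_of_mul_eq_one hE
  have hE1 : ‖E‖ = 1 := by
    have := congrArg norm hE
    rw [norm_mul, RCLike.norm_conj, norm_one] at this
    nlinarith [norm_nonneg E]
  have hF1 : ‖F‖ = 1 := by
    have := congrArg norm hF
    rw [norm_mul, RCLike.norm_conj, norm_one] at this
    nlinarith [norm_nonneg F]
  have hpk : 0 ≤ p * (u * v) := mul_nonneg hp (mul_nonneg hu hv)
  have red : q * (F ^ 2 * (s ^ 2 * (u * v) : ℝ) + (c ^ 2 * (z * w) : ℝ)) =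
      F ^ 2 * (p * (u * v) : ℝ) →
      ‖q * (F ^ 2 * (s ^ 2 * (u * v) : ℝ) + (c ^ 2 * (z * w) : ℝ))‖ = p * (u * v) := by
    intro h
    rw [h, norm_mul, norm_pow, hF1, one_pow, one_mul, Complex.norm_of_nonneg hpk]
  by_cases h0 : q * c ^ 2 * (z * w) = 0
  · have h4 : (p - q * s ^ 2) * (u * v) = 0 := by
      rw [h0, Complex.ofReal_zero, mul_zero] at h₃
      exact_mod_cast (mul_eq_zero.1 h₃).resolve_left hE0
    have h : q * (F ^ 2 * (s ^ 2 * (u * v) : ℝ) + (c ^ 2 * (z * w) : ℝ)) =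
        F ^ 2 * (p * (u * v) : ℝ) := by
      have h0' : ((q * c ^ 2 * (z * w) : ℝ) : ℂ) = 0 := by rw [h0, Complex.ofReal_zero]
      have h4' : (((p - q * s ^ 2) * (u * v) : ℝ) : ℂ) = 0 := by rw [h4, Complex.ofReal_zero]
      push_cast at h0' h4' ⊢
      linear_combination h0' - F ^ 2 * h4'
    exact ⟨red h, Or.inr h⟩
  by_cases hs : s = 0
  · refine ⟨?_, Or.inl hs⟩
    have := congrArg norm h₃
    rw [norm_mul, norm_mul, RCLike.norm_conj, hE1, one_mul, one_mul] at this
    rw [hs] at this ⊢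
    have h5 : (q : ℂ) * (F ^ 2 * (0 ^ 2 * (u * v) : ℝ) + (c ^ 2 * (z * w) : ℝ)) =
        (q * c ^ 2 * (z * w) : ℝ) := by push_cast; ring
    rw [h5, ← this]
    rw [Complex.norm_of_nonneg] <;> simp [hpk]
  have hk : u * v ≠ 0 := by
    intro hk
    rw [hk, mul_zero, Complex.ofReal_zero, mul_zero] at h₃
    have := (mul_eq_zero.1 h₃.symm).resolve_left (by simpa using hE0)
    exact h0 (by exact_mod_cast this)
  have hu0 : u ≠ 0 := left_ne_zero_of_mul hk
  have hv0 : v ≠ 0 := right_ne_zero_of_mul hk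
  have hq0 : q ≠ 0 := fun h => h0 (by simp [h])
  have hc0 : c ≠ 0 := fun h => h0 (by simp [h])
  have hz0 : z ≠ 0 := fun h => h0 (by simp [h])
  have hw0 : w ≠ 0 := fun h => h0 (by simp [h])
  -- All real coefficients are now nonzero, so `EF` and `EF̄` are real. Hence `E² = F²`, and the
  -- third equation can be rewritten in terms of `F`.
  have h₁' : E * F = conj (E * F) := mul_right_cancel₀ (by
    rw [Complex.ofReal_ne_zero]; positivity) h₁
  have h₂' : E * conj F = conj E * F := mul_right_cancel₀ (by
    rw [Complex.ofReal_ne_zero]; positivity) h₂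
  rw [map_mul] at h₁'
  have e1 : E ^ 2 * F ^ 2 = 1 := by
    linear_combination E * F * h₁' + F * conj F * hE + hF
  have e2 : E ^ 2 = F ^ 2 := by
    linear_combination E * F * h₂' - E ^ 2 * hF + F ^ 2 * hE
  have h : q * (F ^ 2 * (s ^ 2 * (u * v) : ℝ) + (c ^ 2 * (z * w) : ℝ)) =
      F ^ 2 * (p * (u * v) : ℝ) := by
    push_cast at h₃ ⊢
    linear_combination -E * h₃ - q * c ^ 2 * (z * w) * hE + (p - q * s ^ 2) * (u * v) * e2
  exact ⟨red h, Or.inr h⟩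

theorem Params.state_eq (p : Params) (h : p.InRange) :
    p.state = ketbra (((√p.ν₁ : ℝ) : ℂ) • p.ψ₁) (((√p.ν₁ : ℝ) : ℂ) • p.ψ₁) +
      ketbra (((√p.ν₂ : ℝ) : ℂ) • p.ψ₂) (((√p.ν₂ : ℝ) : ℂ) • p.ψ₂) := by
  obtain ⟨-, -, -, -, h₁, h₂, -⟩ := h
  rw [ketbra_sqrt_smul h₁.1, ketbra_sqrt_smul h₂.1]
  rfl

theorem Params.state_trace (p : Params) (h : p.ν₁ + p.ν₂ = 1) : p.state.trace = 1 := by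
  rw [state, Matrix.trace_add, Matrix.trace_smul, Matrix.trace_smul, ketbra, ketbra,
    Matrix.trace_vecMulVec, Matrix.trace_vecMulVec, dotProduct_comm, dotProduct_comm p.ψ₂,
    p.ψ₁_normalized, p.ψ₂_normalized, smul_eq_mul, smul_eq_mul, mul_one, mul_one]
  exact_mod_cast h

theorem Params.InRange.trig_nonneg {p : Params} (h : p.InRange) :
    (0 ≤ Real.sin p.θ ∧ 0 ≤ Real.cos p.θ) ∧ (0 ≤ Real.sin p.φ ∧ 0 ≤ Real.cos p.φ) ∧
      0 ≤ Real.sin p.α ∧ 0 ≤ Real.cos p.α := by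
  have key : ∀ t ∈ Set.Icc 0 (Real.pi / 2), 0 ≤ Real.sin t ∧ 0 ≤ Real.cos t := fun t ht =>
    ⟨Real.sin_nonneg_of_nonneg_of_le_pi ht.1 (by linarith [ht.2, Real.pi_pos]),
      Real.cos_nonneg_of_mem_Icc ⟨by linarith [ht.1, Real.pi_pos], ht.2⟩⟩
  exact ⟨key _ h.1, key _ h.2.1, key _ h.2.2.1⟩

theorem Params.isSeparable_of_offDiag_isHermitian (p : Params) (h : p.InRange) {ξ τ : ℝ}
    (hM : (offDiag p.state ξ τ).IsHermitian) : IsSeparable p.state := by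
  obtain ⟨h₁, h₂, h₃⟩ := (p.offDiag_state_isHermitian_iff ξ τ).1 hM
  obtain ⟨⟨hu, hv⟩, -, -⟩ := h.trig_nonneg
  have htr := p.state_trace h.2.2.2.2.2.2
  have hν₁ := h.2.2.2.2.1.1
  have hν₂ := h.2.2.2.2.2.1.1
  have hF := exp_I_mul_conj p.β
  obtain ⟨hn, hX⟩ := weighted_coeffDet_of_hermitian (exp_I_mul_conj τ) hF hν₁ hu hv h₁ h₂ h₃
  rw [p.state_eq h] at htr ⊢
  have sq : ∀ t : ℝ, 0 ≤ t → ((√t : ℝ) : ℂ) ^ 2 = t := fun t ht => by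
    rw [← Complex.ofReal_pow, Real.sq_sqrt ht]
  refine isSeparable_of_coeffDet htr ?_ ?_
  · rw [coeffDet_smul, coeffDet_smul, coeffDet_ψ₁, coeffDet_ψ₂, sq _ hν₁, sq _ hν₂, mul_neg,
      norm_neg, hn, ← Complex.ofReal_mul, Complex.norm_of_nonneg (by positivity)]
  · rw [coeffDet_smul, coeffDet_smul, coeffDetPolar_smul_smul, coeffDet_ψ₁, coeffDet_ψ₂,
      coeffDetPolar_ψ₁_ψ₂, sq _ hν₁, sq _ hν₂]
    rcases hX with hs | hX
    · simp [hs]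
    · rw [mul_neg, hX]
      simp only [map_mul, map_neg, map_pow, Complex.conj_ofReal]
      push_cast
      generalize Complex.exp (Complex.I * p.β) = F at hF ⊢
      linear_combination -(((√p.ν₁ : ℝ) : ℂ) * (√p.ν₂ : ℝ) * p.ν₁ * (Complex.sin p.θ * Complex.cos p.θ) *
        (Complex.sin p.φ * (Complex.sin p.θ ^ 2 - Complex.cos p.θ ^ 2) / 2) * conj F) * hF

/-- With `k = sin θ cos θ`, `m = sin α cos α` and `F r` the polar term, `p h₁ - q h₂` eliminates the
discriminant and gives the equality of moduli. For `r ≠ 0` the phase of `Y` is then forced to be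
that of `F²`. -/
theorem weighted_coeffDet_of_separable {F : ℂ} (hF : F * conj F = 1) {p q s c k m r : ℝ}
    (hp : 0 ≤ p) (hq : 0 ≤ q) (hk : 0 ≤ k) (hpq : p + q = 1)
    (h₁ : p * ‖(k : ℂ)‖ ^ 2 + q * ‖F * r‖ ^ 2 =
      q * ‖k * -(F ^ 2 * (s ^ 2 * k : ℝ) + (c ^ 2 * m : ℝ)) - (F * r) ^ 2‖)
    (h₂ : p * ‖F * r‖ ^ 2 + q * ‖-(F ^ 2 * (s ^ 2 * k : ℝ) + (c ^ 2 * m : ℝ))‖ ^ 2 =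
      p * ‖k * -(F ^ 2 * (s ^ 2 * k : ℝ) + (c ^ 2 * m : ℝ)) - (F * r) ^ 2‖) :
    p * k = q * ‖F ^ 2 * (s ^ 2 * k : ℝ) + (c ^ 2 * m : ℝ)‖ ∧
      (r ≠ 0 → (((p - q * s ^ 2) * k : ℝ) : ℂ) = conj F ^ 2 * (q * c ^ 2 * m : ℝ)) := by
  set Y : ℂ := F ^ 2 * (s ^ 2 * k : ℝ) + (c ^ 2 * m : ℝ) with hY
  rw [norm_neg] at h₂
  rw [Complex.norm_of_nonneg hk] at h₁
  have hD : ‖k * -Y - (F * r) ^ 2‖ = ‖k * Y + (F * r) ^ 2‖ := by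
    rw [← norm_neg]; congr 1; ring
  rw [hD] at h₁ h₂
  have hkY : p * k = q * ‖Y‖ := by
    rw [← sq_eq_sq₀ (mul_nonneg hp hk) (mul_nonneg hq (norm_nonneg _))]
    linear_combination p * h₁ - q * h₂
  refine ⟨hkY, fun hr => ?_⟩
  rcases hq.eq_or_lt with rfl | hq0
  · have hp1 : p = 1 := by linarith
    have : k = 0 := by simpa [hp1] using h₁
    simp [this]
  -- Substituting `p k = q ‖Y‖` into `h₁` turns it into equality in the triangle inequality for `kY`
  -- and `(F r)²`.
  have hray : SameRay ℝ ((k : ℂ) * Y) ((F * r) ^ 2) := by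
    rw [sameRay_iff_norm_add, norm_mul, Complex.norm_of_nonneg hk, norm_pow]
    apply mul_left_cancel₀ hq0.ne'
    rw [← h₁]
    linear_combination k * hkY
  have hF1 : ‖F‖ = 1 := by
    have := congrArg norm hF
    rw [norm_mul, RCLike.norm_conj, norm_one] at this
    nlinarith [norm_nonneg F]
  have hsm := sameRay_iff_norm_smul_eq.1 hray
  rw [norm_mul, Complex.norm_of_nonneg hk, norm_pow, norm_mul, hF1, one_mul, Complex.norm_real,
    Real.norm_eq_abs, sq_abs, Complex.real_smul, Complex.real_smul] at hsm
  push_cast at hsm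
  have hr' : (r : ℂ) ^ 2 ≠ 0 := pow_ne_zero _ (by exact_mod_cast hr)
  have hkY' : (p : ℂ) * k = q * ‖Y‖ := by exact_mod_cast hkY
  have h3 : (k : ℂ) * (p * k * F ^ 2 - q * Y) = 0 := by
    apply mul_left_cancel₀ hr'
    linear_combination q * hsm + r ^ 2 * k * F ^ 2 * hkY'
  rcases mul_eq_zero.1 h3 with h0 | h4
  · have hk0 : k = 0 := by exact_mod_cast h0
    have : q * ‖Y‖ = 0 := by rw [← hkY, hk0, mul_zero]
    have hY0 : Y = 0 := norm_eq_zero.1 ((mul_eq_zero.1 this).resolve_left hq0.ne')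
    rw [hY, hk0, mul_zero, Complex.ofReal_zero, mul_zero, zero_add] at hY0
    have : c ^ 2 * m = 0 := by exact_mod_cast hY0
    rw [hk0, mul_assoc q, this]
    simp
  · rw [hY] at h4
    push_cast at h4 ⊢
    linear_combination conj F ^ 2 * h4 - (p - q * s ^ 2) * k * (F * conj F + 1) * hF

theorem eq_pi_div_four_of_sin_sq_sub_cos_sq {t : ℝ} (ht : t ∈ Set.Icc 0 (Real.pi / 2))
    (h : Real.sin t ^ 2 - Real.cos t ^ 2 = 0) : t = Real.pi / 4 := by
  have h2 : Real.cos (2 * t) = Real.cos (Real.pi / 2) := by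
    rw [Real.cos_two_mul', Real.cos_pi_div_two]; linarith
  have := Real.injOn_cos ⟨by linarith [ht.1], by linarith [ht.2]⟩
    ⟨by linarith [Real.pi_pos], by linarith [Real.pi_pos]⟩ h2
  linarith

theorem Params.exists_offDiag_isHermitian (p : Params) (h : p.InRange)
    (hθ : p.θ = Real.pi / 4 → p.φ = 0 ∨ p.φ = Real.pi / 2) (hsep : IsSeparable p.state) :
    ∃ ξ τ : ℝ, (offDiag p.state ξ τ).IsHermitian := by
  obtain ⟨⟨hu, hv⟩, ⟨hs, hc⟩, hz, hw⟩ := h.trig_nonneg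
  have hF := exp_I_mul_conj p.β
  obtain ⟨c₁, c₂⟩ := hsep.coeffDet_eq p.ψ₁_normalized p.ψ₂_normalized p.ψ₁_orthogonal_ψ₂
    h.2.2.2.2.2.2
  rw [coeffDet_ψ₁, coeffDet_ψ₂, coeffDetPolar_ψ₁_ψ₂] at c₁ c₂
  obtain ⟨g₁, g₂⟩ := weighted_coeffDet_of_separable hF h.2.2.2.2.1.1 h.2.2.2.2.2.1.1
    (mul_nonneg hu hv) h.2.2.2.2.2.2 c₁ c₂
  simp only [offDiag_state_isHermitian_iff]
  have hF1 : ‖Complex.exp (Complex.I * p.β)‖ = 1 := by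
    rw [mul_comm, Complex.norm_exp_ofReal_mul_I]
  by_cases hs0 : Real.sin p.φ = 0
  · have hc1 : Real.cos p.φ ^ 2 = 1 := by
      have := Real.sin_sq_add_cos_sq p.φ
      rw [hs0] at this; linarith
    have hm : 0 ≤ Real.sin p.α * Real.cos p.α := mul_nonneg hz hw
    rw [hs0, hc1] at g₁
    have g₁' : p.ν₁ * (Real.sin p.θ * Real.cos p.θ) = p.ν₂ * (Real.sin p.α * Real.cos p.α) := by
      rw [g₁]
      congr 1
      rw [zero_pow two_ne_zero, zero_mul, Complex.ofReal_zero, mul_zero, zero_add, one_mul,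
        Complex.norm_of_nonneg hm]
    refine ⟨0, 0, ?_, ?_, ?_⟩
    · simp [hs0]
    · simp [hs0]
    · rw [hs0, hc1, zero_pow two_ne_zero, mul_zero, sub_zero, mul_one, g₁']
      simp
  by_cases hc0 : Real.cos p.φ = 0
  · have hs1 : Real.sin p.φ ^ 2 = 1 := by
      have := Real.sin_sq_add_cos_sq p.φ
      rw [hc0] at this; linarith
    rw [hc0, hs1, zero_pow two_ne_zero, zero_mul, Complex.ofReal_zero, add_zero, one_mul, norm_mul,
      norm_pow, hF1, one_pow, one_mul, Complex.norm_of_nonneg (mul_nonneg hu hv)] at g₁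
    refine ⟨0, 0, by simp [hc0], by simp [hc0], ?_⟩
    rw [hs1, hc0, mul_one, sub_mul, g₁]
    simp
  have hθ' : Real.sin p.θ ^ 2 - Real.cos p.θ ^ 2 ≠ 0 := by
    intro h0
    rcases hθ (eq_pi_div_four_of_sin_sq_sub_cos_sq h.1 h0) with h1 | h1
    · exact hs0 (by rw [h1, Real.sin_zero])
    · exact hc0 (by rw [h1, Real.cos_pi_div_two])
  -- This is where `θ ≠ π/4` is needed: the polar term is proportional to `sin φ (sin² θ - cos² θ)`.
  have K := g₂ (div_ne_zero (mul_ne_zero hs0 hθ') two_ne_zero)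
  by_cases hw0 : Real.cos p.α = 0
  · refine ⟨0, -p.β, ?_, by simp [hw0], ?_⟩
    · have : Complex.exp (Complex.I * ((-p.β : ℝ) : ℂ)) * Complex.exp (Complex.I * p.β) = 1 := by
        rw [← Complex.exp_add]; simp
      rw [this, map_one]
    · rw [hw0, mul_zero, mul_zero, Complex.ofReal_zero, mul_zero] at K
      rw [K, hw0]; simp
  · refine ⟨0, p.β, ?_, by ring, ?_⟩
    · by_cases hb : p.ν₂ * Real.cos p.φ ^ 2 * (Real.sin p.α * Real.cos p.α) = 0
      · have : p.ν₂ = 0 ∨ Real.sin p.α = 0 := by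
          simpa [hc0, hw0] using hb
        rcases this with h0 | h0 <;> simp [h0]
      · generalize Complex.exp (Complex.I * p.β) = F at *
        have K' := congrArg conj K
        rw [map_mul, map_pow, Complex.conj_conj, Complex.conj_ofReal, Complex.conj_ofReal, K] at K'
        have : conj F ^ 2 = F ^ 2 := mul_right_cancel₀ (Complex.ofReal_ne_zero.2 hb) K'
        rw [← sq, ← this, map_pow, Complex.conj_conj, this]
    · rw [K, ← mul_assoc, pow_two (conj _), ← mul_assoc, hF, one_mul]

/-! ### Angles, phases and the singular value decomposition -/

theorem exists_angle {s t : ℝ} (hs : 0 ≤ s) (ht : 0 ≤ t) (h : s ^ 2 + t ^ 2 = 1) :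
    ∃ a ∈ Set.Icc 0 (Real.pi / 2), Real.cos a = s ∧ Real.sin a = t := by
  refine ⟨Real.arccos s, ⟨Real.arccos_nonneg s, Real.arccos_le_pi_div_two.2 hs⟩,
    Real.cos_arccos (by linarith) (by nlinarith), ?_⟩
  rw [Real.sin_arccos, ← Real.sqrt_sq ht]
  congr 1
  linarith

theorem exists_phase (z : ℂ) :
    ∃ t ∈ Set.Icc 0 (2 * Real.pi), z = ‖z‖ * Complex.exp (Complex.I * (t : ℝ)) := by
  have h0 := Complex.norm_mul_exp_arg_mul_I z
  rcases le_or_gt 0 z.arg with h | h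
  · refine ⟨z.arg, ⟨h, by linarith [Complex.arg_le_pi z, Real.pi_pos]⟩, ?_⟩
    rw [mul_comm Complex.I, h0]
  · refine ⟨z.arg + 2 * Real.pi, ⟨by linarith [Complex.neg_pi_lt_arg z], by linarith⟩, ?_⟩
    rw [mul_comm Complex.I, Complex.ofReal_add, add_mul, Complex.exp_add]
    push_cast
    rw [Complex.exp_two_pi_mul_I, mul_one, h0]

theorem mem_unitaryGroup_fin_two {U : Op1} :
    U ∈ Matrix.unitaryGroup (Fin 2) ℂ ↔
      conj (U 0 0) * U 0 0 + conj (U 1 0) * U 1 0 = 1 ∧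
      conj (U 0 0) * U 0 1 + conj (U 1 0) * U 1 1 = 0 ∧
      conj (U 0 1) * U 0 0 + conj (U 1 1) * U 1 0 = 0 ∧
      conj (U 0 1) * U 0 1 + conj (U 1 1) * U 1 1 = 1 := by
  rw [Matrix.mem_unitaryGroup_iff', ← Matrix.ext_iff]
  simp [Fin.forall_fin_two, Matrix.mul_apply, Fin.sum_univ_two, Matrix.star_apply, and_assoc]

theorem column_completion_mem_unitaryGroup {a b : ℂ} {k : ℂ} (h : conj a * a + conj b * b = 1)
    (hk : k * conj k = 1) :
    (!![a, -k * conj b; b, k * conj a] : Op1) ∈ Matrix.unitaryGroup (Fin 2) ℂ := by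
  rw [mem_unitaryGroup_fin_two]
  simp only [Matrix.of_apply, Matrix.cons_val', Matrix.cons_val_zero, Matrix.cons_val_one,
    Matrix.cons_val_fin_one, map_mul, map_neg, Complex.conj_conj]
  refine ⟨h, by ring, by ring, ?_⟩
  linear_combination k * conj k * h + hk

/-- A nonzero vector of `ℂ²` is a positive multiple of a unit vector. -/
theorem exists_normalize {x y : ℂ} (h : ¬(x = 0 ∧ y = 0)) :
    ∃ (s : ℝ) (a b : ℂ), 0 < s ∧ x = s * a ∧ y = s * b ∧ conj a * a + conj b * b = 1 := by
  have hpos : 0 < ‖x‖ ^ 2 + ‖y‖ ^ 2 := by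
    by_cases hx : x = 0
    · have hy : y ≠ 0 := fun hy => h ⟨hx, hy⟩
      positivity
    · positivity
  set s := √(‖x‖ ^ 2 + ‖y‖ ^ 2) with hs
  have hs0 : 0 < s := Real.sqrt_pos.2 hpos
  have hsc : (s : ℂ) ≠ 0 := by exact_mod_cast hs0.ne'
  refine ⟨s, x / s, y / s, hs0, by field_simp, by field_simp, ?_⟩
  have hsq : (s : ℂ) ^ 2 = conj x * x + conj y * y := by
    rw [mul_comm, Complex.mul_conj, mul_comm, Complex.mul_conj, Complex.normSq_eq_norm_sq,
      Complex.normSq_eq_norm_sq, ← Complex.ofReal_pow, hs, Real.sq_sqrt hpos.le]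
    push_cast; rfl
  simp only [map_div₀, Complex.conj_ofReal]
  field_simp
  linear_combination -hsq

/-- A matrix with orthogonal columns is a unitary times a nonnegative diagonal matrix. -/
theorem exists_unitary_mul_diagonal (B : Op1)
    (h : conj (B 0 0) * B 0 1 + conj (B 1 0) * B 1 1 = 0) :
    ∃ U ∈ Matrix.unitaryGroup (Fin 2) ℂ, ∃ s t : ℝ, 0 ≤ s ∧ 0 ≤ t ∧
      B = U * Matrix.diagonal ![(s : ℂ), (t : ℂ)] := by
  by_cases h0 : B 0 0 = 0 ∧ B 1 0 = 0
  · by_cases h1 : B 0 1 = 0 ∧ B 1 1 = 0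
    · refine ⟨1, one_mem _, 0, 0, le_rfl, le_rfl, ?_⟩
      ext i j
      fin_cases i <;> fin_cases j <;> simp [h0, h1]
    · obtain ⟨s, a, b, hs, ha, hb, hab⟩ := exists_normalize h1
      refine ⟨!![conj b, a; -conj a, b], ?_, 0, s, le_rfl, hs.le, ?_⟩
      · rw [mem_unitaryGroup_fin_two]
        simp only [Matrix.of_apply, Matrix.cons_val', Matrix.cons_val_zero, Matrix.cons_val_one,
          Matrix.cons_val_fin_one, map_neg, Complex.conj_conj]
        exact ⟨by linear_combination hab, by ring, by ring, hab⟩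
      · ext i j
        fin_cases i <;> fin_cases j <;> simp [h0, ha, hb, mul_comm]
  · obtain ⟨s, a, b, hs, ha, hb, hab⟩ := exists_normalize h0
    have hsc : (s : ℂ) ≠ 0 := by exact_mod_cast hs.ne'
    -- The second column is orthogonal to `(a, b)`, hence equals `z (-b̄, ā)`. The phase of `z` goes
    -- into the unitary, its modulus into the diagonal.
    set z : ℂ := a * B 1 1 - b * B 0 1 with hz
    obtain ⟨t, -, ht⟩ := exists_phase z
    have horth : conj a * B 0 1 + conj b * B 1 1 = 0 := by
      apply (mul_eq_zero.1 (_ : (s : ℂ) * _ = 0)).resolve_left hsc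
      rw [ha, hb, map_mul, map_mul, Complex.conj_ofReal] at h
      linear_combination h
    refine ⟨_, column_completion_mem_unitaryGroup hab (exp_I_mul_conj t), s, ‖z‖, hs.le, norm_nonneg z, ?_⟩
    have e1 : B 0 1 = -Complex.exp (Complex.I * t) * conj b * ‖z‖ := by
      linear_combination a * horth - B 0 1 * hab + conj b * hz - conj b * ht
    have e2 : B 1 1 = Complex.exp (Complex.I * t) * conj a * ‖z‖ := by
      linear_combination b * horth - B 1 1 * hab - conj a * hz + conj a * ht
    ext i j
    fin_cases i <;> fin_cases j <;> simp [ha, hb, e1, e2, mul_comm]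

/-- Singular value decomposition of a `2 × 2` matrix. -/
theorem exists_svd (A : Op1) :
    ∃ U ∈ Matrix.unitaryGroup (Fin 2) ℂ, ∃ V ∈ Matrix.unitaryGroup (Fin 2) ℂ, ∃ s t : ℝ,
      0 ≤ s ∧ 0 ≤ t ∧ U * A * Vᵀ = Matrix.diagonal ![(s : ℂ), (t : ℂ)] := by
  have hH := Matrix.isHermitian_conjTranspose_mul_self A
  set W := hH.eigenvectorUnitary
  have hd := hH.conjStarAlgAut_star_eigenvectorUnitary
  rw [Unitary.conjStarAlgAut_star_apply] at hd
  -- Since `W` diagonalizes `AᴴA`, the columns of `A W` are orthogonal.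
  set B : Op1 := A * (W : Op1) with hB
  have hBB : Bᴴ * B = Matrix.diagonal (RCLike.ofReal ∘ hH.eigenvalues) := by
    rw [← hd, hB, Matrix.conjTranspose_mul]
    simp only [Matrix.mul_assoc, Matrix.star_eq_conjTranspose]
    rfl
  have horth : conj (B 0 0) * B 0 1 + conj (B 1 0) * B 1 1 = 0 := by
    have := congrFun (congrFun hBB 0) 1
    simpa [Matrix.mul_apply, Fin.sum_univ_two] using this
  obtain ⟨U, hU, s, t, hs, ht, hBU⟩ := exists_unitary_mul_diagonal B horth
  refine ⟨star U, Unitary.star_mem hU, (W : Op1)ᵀ, ?_, s, t, hs, ht, ?_⟩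
  · exact Matrix.transpose_mem_unitaryGroup_iff.2 W.2
  · rw [Matrix.transpose_transpose, Matrix.mul_assoc, ← hB, hBU, ← Matrix.mul_assoc,
      Matrix.mem_unitaryGroup_iff'.1 hU, Matrix.one_mul]

/-- The coefficient matrix of a two-qubit vector. -/
def coeffMatrix (w : Fin 2 × Fin 2 → ℂ) : Op1 := Matrix.of fun i j => w (i, j)

theorem coeffMatrix_kronecker_mulVec (U V : Op1) (w : Fin 2 × Fin 2 → ℂ) :
    coeffMatrix ((U ⊗ₖ V) *ᵥ w) = U * coeffMatrix w * Vᵀ := by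
  ext i j
  simp only [coeffMatrix, Matrix.of_apply, Matrix.mulVec, dotProduct, Fintype.sum_prod_type,
    Matrix.kroneckerMap_apply, Matrix.mul_apply, Matrix.transpose_apply, Fin.sum_univ_two]
  ring

theorem star_mulVec_dotProduct_mulVec {ι : Type} [Fintype ι] [DecidableEq ι] {W : Matrix ι ι ℂ}
    (hW : W ∈ Matrix.unitaryGroup ι ℂ) (v w : ι → ℂ) :
    star (W *ᵥ v) ⬝ᵥ (W *ᵥ w) = star v ⬝ᵥ w := by
  rw [Matrix.star_mulVec, ← Matrix.dotProduct_mulVec, Matrix.mulVec_mulVec,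
    ← Matrix.star_eq_conjTranspose, Matrix.mem_unitaryGroup_iff'.1 hW, Matrix.one_mulVec]

theorem mul_ketbra_mul {ι : Type} [Fintype ι] (W : Matrix ι ι ℂ) (v : ι → ℂ) :
    W * ketbra v v * Wᴴ = ketbra (W *ᵥ v) (W *ᵥ v) := by
  rw [ketbra, ketbra, Matrix.mul_vecMulVec, Matrix.vecMulVec_mul, Matrix.star_mulVec]

theorem ketbra_smul_of_unit {ι : Type} {c : ℂ} (hc : c * conj c = 1) (v : ι → ℂ) :
    ketbra (c • v) (c • v) = ketbra v v := by
  ext i j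
  simp only [ketbra_apply, Pi.smul_apply, smul_eq_mul, star_mul, Complex.star_def]
  linear_combination v i * conj (v j) * hc

theorem exists_polar {x y : ℝ} (hx : 0 ≤ x) (hy : 0 ≤ y) :
    ∃ r : ℝ, 0 ≤ r ∧ r ^ 2 = x ^ 2 + y ^ 2 ∧
      ∃ a ∈ Set.Icc 0 (Real.pi / 2), x = r * Real.cos a ∧ y = r * Real.sin a := by
  have hsq : √(x ^ 2 + y ^ 2) ^ 2 = x ^ 2 + y ^ 2 := Real.sq_sqrt (by positivity)
  refine ⟨√(x ^ 2 + y ^ 2), Real.sqrt_nonneg _, hsq, ?_⟩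
  set r := √(x ^ 2 + y ^ 2) with hr
  rcases (Real.sqrt_nonneg (x ^ 2 + y ^ 2)).eq_or_lt with h0 | h0
  · rw [← hr] at h0
    rw [← h0] at hsq ⊢
    have hx0 : x = 0 := by nlinarith
    have hy0 : y = 0 := by nlinarith
    exact ⟨0, ⟨le_rfl, by positivity⟩, by simp [hx0], by simp [hy0]⟩
  · rw [← hr] at h0
    obtain ⟨a, ha, hc, hs⟩ := exists_angle (div_nonneg hx h0.le) (div_nonneg hy h0.le)
      (by rw [div_pow, div_pow, ← add_div, ← hsq, div_self (by positivity)])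
    exact ⟨a, ha, by rw [hc]; field_simp, by rw [hs]; field_simp⟩

/-! ### Reduction of a rank-two state to normal form -/

theorem kronecker_mem_unitaryGroup {U V : Op1} (hU : U ∈ Matrix.unitaryGroup (Fin 2) ℂ)
    (hV : V ∈ Matrix.unitaryGroup (Fin 2) ℂ) :
    U ⊗ₖ V ∈ Matrix.unitaryGroup (Fin 2 × Fin 2) ℂ :=
  Matrix.kronecker_mem_unitary hU hV

theorem kronecker_mulVec_mulVec (A B U V : Op1) (w : Fin 2 × Fin 2 → ℂ) :
    (A ⊗ₖ B) *ᵥ ((U ⊗ₖ V) *ᵥ w) = ((A * U) ⊗ₖ (B * V)) *ᵥ w := by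
  rw [Matrix.mulVec_mulVec, Matrix.mul_kronecker_mul]

theorem diagonal_phase_mem_unitaryGroup (u : ℝ) :
    (Matrix.diagonal ![1, Complex.exp (Complex.I * u)] : Op1) ∈ Matrix.unitaryGroup (Fin 2) ℂ := by
  rw [mem_unitaryGroup_fin_two]
  have := exp_I_mul_conj u
  rw [mul_comm] at this
  simp [this]

/-- Two orthonormal vectors can be brought to the parametrized form by local unitaries. -/
theorem exists_params {e f : Fin 2 × Fin 2 → ℂ} (hee : star e ⬝ᵥ e = 1) (hff : star f ⬝ᵥ f = 1)
    (hef : star e ⬝ᵥ f = 0) {ν₁ ν₂ : ℝ} (h₁ : 0 ≤ ν₁) (h₂ : 0 ≤ ν₂) (hν : ν₁ + ν₂ = 1) :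
    ∃ U ∈ Matrix.unitaryGroup (Fin 2) ℂ, ∃ V ∈ Matrix.unitaryGroup (Fin 2) ℂ,
      ∃ p : Params, p.InRange ∧ p.ν₁ = ν₁ ∧ p.ν₂ = ν₂ ∧ (U ⊗ₖ V) *ᵥ e = p.ψ₁ ∧
        ∃ c : ℂ, c * conj c = 1 ∧ (U ⊗ₖ V) *ᵥ f = c • p.ψ₂ := by
  obtain ⟨U, hU, V, hV, s, t, hs, ht, hst⟩ := exists_svd (coeffMatrix e)
  have hUV := kronecker_mem_unitaryGroup hU hV
  rw [← coeffMatrix_kronecker_mulVec] at hst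
  rw [← star_mulVec_dotProduct_mulVec hUV] at hee hff hef
  set e' := (U ⊗ₖ V) *ᵥ e with he'
  set g := (U ⊗ₖ V) *ᵥ f with hg
  have e00 : e' (0, 0) = s := by simpa [coeffMatrix] using congrFun (congrFun hst 0) 0
  have e01 : e' (0, 1) = 0 := by simpa [coeffMatrix] using congrFun (congrFun hst 0) 1
  have e10 : e' (1, 0) = 0 := by simpa [coeffMatrix] using congrFun (congrFun hst 1) 0
  have e11 : e' (1, 1) = t := by simpa [coeffMatrix] using congrFun (congrFun hst 1) 1
  simp only [dotProduct, Fintype.sum_prod_type, Fin.sum_univ_two, Pi.star_apply, e00, e01, e10,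
    e11, Complex.star_def, Complex.conj_ofReal, map_zero, zero_mul, add_zero, zero_add]
    at hee hff hef
  have hst1 : s ^ 2 + t ^ 2 = 1 := by
    have : ((s ^ 2 + t ^ 2 : ℝ) : ℂ) = 1 := by push_cast; linear_combination hee
    exact_mod_cast this
  have hst1' : (s : ℂ) ^ 2 + (t : ℂ) ^ 2 = 1 := by exact_mod_cast hst1
  obtain ⟨θ, hθ, hcθ, hsθ⟩ := exists_angle hs ht hst1
  obtain ⟨a, -, ha⟩ := exists_phase (g (0, 1))
  obtain ⟨b, -, hb⟩ := exists_phase (g (1, 0))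
  -- Common phase of the `|01⟩` and `|10⟩` components after the correction by `u` below; it is
  -- factored out of the second vector.
  set κ : ℂ := Complex.exp (Complex.I * ((a + b) / 2 : ℝ)) with hκ
  have hκ1 : κ * conj κ = 1 := exp_I_mul_conj _
  -- Apart from `κ̄`, the component along `sin θ |00⟩ - cos θ |11⟩`; orthogonality to the first
  -- vector leaves no other component in the span of `|00⟩` and `|11⟩`.
  set z : ℂ := conj κ * (t * g (0, 0) - s * g (1, 1)) with hz
  obtain ⟨β, hβ, hzβ⟩ := exists_phase z
  obtain ⟨C, hC, hCsq, α, hα, hqα, hrα⟩ := exists_polar (norm_nonneg (g (0, 1)))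
    (norm_nonneg (g (1, 0)))
  have hCz : C ^ 2 + ‖z‖ ^ 2 = 1 := by
    have hn : ∀ x : ℂ, ((‖x‖ ^ 2 : ℝ) : ℂ) = conj x * x := fun x => by
      rw [mul_comm, Complex.mul_conj, Complex.normSq_eq_norm_sq]
    have : ((C ^ 2 + ‖z‖ ^ 2 : ℝ) : ℂ) = 1 := by
      rw [hCsq, Complex.ofReal_add, Complex.ofReal_add, hn, hn, hn, hz]
      simp only [map_mul, map_sub, Complex.conj_conj, Complex.conj_ofReal]
      linear_combination hff + (t * conj (g (0, 0)) - s * conj (g (1, 1))) *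
        (t * g (0, 0) - s * g (1, 1)) * hκ1 +
        (conj (g (0, 0)) * g (0, 0) + conj (g (1, 1)) * g (1, 1)) * hst1' -
        (s * conj (g (0, 0)) + t * conj (g (1, 1))) * hef
    exact_mod_cast this
  obtain ⟨φ, hφ, hcφ, hsφ⟩ := exists_angle hC (norm_nonneg z) hCz
  -- `diag(1, e^{iu}) ⊗ diag(1, e^{-iu})` fixes `|00⟩` and `|11⟩`, hence the Schmidt form, and this
  -- `u` equalizes the phases `a` and `b`.
  set u : ℝ := (a - b) / 2 with hu
  refine ⟨_, mul_mem (diagonal_phase_mem_unitaryGroup u) hU, _,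
    mul_mem (diagonal_phase_mem_unitaryGroup (-u)) hV, ⟨ν₁, ν₂, θ, φ, α, β⟩,
    ⟨hθ, hφ, hα, hβ, ⟨h₁, by linarith⟩, ⟨h₂, by linarith⟩, hν⟩, rfl, rfl, ?_, κ, hκ1, ?_⟩
  · obtain ⟨k1, k2, k3, k4⟩ := Params.ψ₁_apply ⟨ν₁, ν₂, θ, φ, α, β⟩
    have huu : Complex.exp (Complex.I * u) * Complex.exp (Complex.I * ((-u : ℝ) : ℂ)) = 1 := by
      rw [← Complex.exp_add]; simp
    rw [← kronecker_mulVec_mulVec, ← he']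
    ext ⟨i, j⟩
    fin_cases i <;> fin_cases j <;>
      simp only [Fin.zero_eta, Fin.mk_one, k1, k2, k3, k4, Matrix.mulVec, dotProduct,
        Fintype.sum_prod_type, Fin.sum_univ_two, Matrix.kroneckerMap_apply, e00, e01, e10, e11,
        Matrix.diagonal_apply, hcθ, hsθ]
    · simp
    · simp
    · simp
    · suffices Complex.exp (Complex.I * u) * Complex.exp (Complex.I * ((-u : ℝ) : ℂ)) * t = t by
        simpa using this
      rw [huu, one_mul]
  · obtain ⟨k1, k2, k3, k4⟩ := Params.ψ₂_apply ⟨ν₁, ν₂, θ, φ, α, β⟩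
    have huu : Complex.exp (Complex.I * u) * Complex.exp (Complex.I * ((-u : ℝ) : ℂ)) = 1 := by
      rw [← Complex.exp_add]; simp
    have hq : Complex.exp (Complex.I * ((-u : ℝ) : ℂ)) * Complex.exp (Complex.I * a) = κ := by
      rw [← Complex.exp_add, hκ, hu]; congr 1; push_cast; ring
    have hr : Complex.exp (Complex.I * u) * Complex.exp (Complex.I * b) = κ := by
      rw [← Complex.exp_add, hκ, hu]; congr 1; push_cast; ring
    have hqα' : (‖g (0, 1)‖ : ℂ) = C * Real.cos α := by exact_mod_cast hqα
    have hrα' : (‖g (1, 0)‖ : ℂ) = C * Real.sin α := by exact_mod_cast hrα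
    have hκz : κ * (Complex.exp (Complex.I * β) * ‖z‖) = t * g (0, 0) - s * g (1, 1) := by
      linear_combination (-κ) * hzβ + κ * hz + (t * g (0, 0) - s * g (1, 1)) * hκ1
    rw [← kronecker_mulVec_mulVec, ← hg]
    ext ⟨i, j⟩
    fin_cases i <;> fin_cases j <;>
      simp only [Fin.zero_eta, Fin.mk_one, k1, k2, k3, k4, Matrix.mulVec, dotProduct,
        Fintype.sum_prod_type, Fin.sum_univ_two, Matrix.kroneckerMap_apply,
        Matrix.diagonal_apply, hcθ, hsθ, hcφ, hsφ, Pi.smul_apply, smul_eq_mul]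
    · suffices g (0, 0) = κ * (Complex.exp (Complex.I * β) * ‖z‖ * t) by simpa using this
      linear_combination (-t) * hκz - g (0, 0) * hst1' + s * hef
    · suffices Complex.exp (Complex.I * ((-u : ℝ) : ℂ)) * g (0, 1) = κ * (C * Real.cos α) by
        simpa using this
      rw [← hqα']
      linear_combination Complex.exp (Complex.I * ((-u : ℝ) : ℂ)) * ha + ‖g (0, 1)‖ * hq
    · suffices Complex.exp (Complex.I * u) * g (1, 0) = κ * (C * Real.sin α) by
        simpa using this
      rw [← hrα']
      linear_combination Complex.exp (Complex.I * u) * hb + ‖g (1, 0)‖ * hr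
    · suffices Complex.exp (Complex.I * u) * Complex.exp (Complex.I * ((-u : ℝ) : ℂ)) * g (1, 1) =
          -(κ * (Complex.exp (Complex.I * β) * ‖z‖ * s)) by simpa using this
      linear_combination g (1, 1) * huu + s * hκz - g (1, 1) * hst1' + t * hef

/-- A traceless `2 × 2` unitary matrix is, up to a phase, unitarily equivalent to `diag(1, -1)`. -/
theorem exists_diagonalize_traceless {W : Op1} (hW : W ∈ Matrix.unitaryGroup (Fin 2) ℂ)
    (htr : W 0 0 + W 1 1 = 0) :
    ∃ P ∈ Matrix.unitaryGroup (Fin 2) ℂ, ∃ c : ℂ, c * conj c = 1 ∧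
      star P * W * P = c • Matrix.diagonal ![1, -1] := by
  -- By Cayley–Hamilton a traceless `W` satisfies `W² = -det W`. With `δ² = -det W`, the matrix `δ̄
  -- W` is both unitary and Hermitian, so its eigenvalues are `±1`, of opposite sign by
  -- tracelessness.
  obtain ⟨δ, hδ⟩ := IsAlgClosed.exists_pow_nat_eq (W 0 0 ^ 2 + W 0 1 * W 1 0) (n := 2) (by norm_num)
  have hWW : W * W = δ ^ 2 • (1 : Op1) := by
    rw [hδ]
    ext i j
    fin_cases i <;> fin_cases j <;> simp [Matrix.mul_apply, Fin.sum_univ_two]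
    · ring
    · linear_combination W 0 1 * htr
    · linear_combination W 1 0 * htr
    · linear_combination (W 1 1 - W 0 0) * htr
  have hδ1 : δ * conj δ = 1 := by
    have hdet : ‖W.det‖ = 1 := CStarRing.norm_of_mem_unitary (Matrix.det_of_mem_unitary hW)
    have : W.det = -δ ^ 2 := by
      rw [Matrix.det_fin_two, hδ]; linear_combination W 0 0 * htr
    rw [this, norm_neg, norm_pow] at hdet
    rw [Complex.mul_conj, Complex.normSq_eq_norm_sq, hdet, Complex.ofReal_one]
  have hstar : star W = conj δ ^ 2 • W := by
    have h1 : star W * (W * W) = W := by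
      rw [← Matrix.mul_assoc, Matrix.mem_unitaryGroup_iff'.1 hW, Matrix.one_mul]
    rw [hWW, Matrix.mul_smul, Matrix.mul_one] at h1
    rw [← h1, smul_smul, h1, ← mul_pow, mul_comm, hδ1, one_pow, one_smul]
  have hH : (conj δ • W).IsHermitian := by
    rw [Matrix.IsHermitian, Matrix.conjTranspose_smul, ← Matrix.star_eq_conjTranspose, hstar,
      smul_smul, Complex.star_def, Complex.conj_conj]
    congr 1
    linear_combination conj δ * hδ1
  have hd := hH.conjStarAlgAut_star_eigenvectorUnitary
  rw [Unitary.conjStarAlgAut_star_apply] at hd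
  set P : Op1 := (hH.eigenvectorUnitary : Op1) with hP
  have hPu : P ∈ Matrix.unitaryGroup (Fin 2) ℂ := hH.eigenvectorUnitary.2
  have hPW : star P * W * P = δ • Matrix.diagonal (RCLike.ofReal ∘ hH.eigenvalues) := by
    rw [← hd, Matrix.mul_smul, Matrix.smul_mul, smul_smul, hδ1, one_smul]
  have htr' : (hH.eigenvalues 0 : ℂ) + hH.eigenvalues 1 = 0 := by
    have := hH.trace_eq_sum_eigenvalues
    rw [Matrix.trace_smul, Matrix.trace_fin_two, htr, smul_zero, Fin.sum_univ_two] at this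
    exact this.symm
  have hsq : (hH.eigenvalues 0 : ℂ) ^ 2 = 1 := by
    have := hH.det_eq_prod_eigenvalues
    rw [Fin.prod_univ_two, Matrix.det_fin_two] at this
    simp only [Matrix.smul_apply, smul_eq_mul] at this
    have this' : conj δ * W 0 0 * (conj δ * W 1 1) - conj δ * W 0 1 * (conj δ * W 1 0) =
      (hH.eigenvalues 0 : ℂ) * hH.eigenvalues 1 := this
    linear_combination (hH.eigenvalues 0 : ℂ) * htr' + this' - conj δ ^ 2 * W 0 0 * htr +
      (δ * conj δ + 1) * hδ1 - conj δ ^ 2 * hδ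
  refine ⟨P, hPu, δ * hH.eigenvalues 0, ?_, ?_⟩
  · rw [map_mul, Complex.conj_ofReal]
    linear_combination (hH.eigenvalues 0 : ℂ) ^ 2 * hδ1 + hsq
  · rw [hPW]
    ext i j
    fin_cases i <;> fin_cases j <;> simp
    linear_combination δ * htr'

theorem coeffMatrix_injective : Function.Injective coeffMatrix := fun _ _ h =>
  funext fun i => congrFun (congrFun h i.1) i.2

theorem coeffMatrix_smul (c : ℂ) (w : Fin 2 × Fin 2 → ℂ) :
    coeffMatrix (c • w) = c • coeffMatrix w := rfl

theorem coeffMatrix_ψ₁_of_eq_pi_div_four {p : Params} (h : p.θ = Real.pi / 4) :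
    coeffMatrix p.ψ₁ = ((√2 / 2 : ℝ) : ℂ) • (1 : Op1) := by
  obtain ⟨h1, h2, h3, h4⟩ := p.ψ₁_apply
  rw [h, Real.cos_pi_div_four] at h1
  rw [h, Real.sin_pi_div_four] at h4
  ext i j
  fin_cases i <;> fin_cases j <;>
    simp only [coeffMatrix, Matrix.of_apply, Fin.zero_eta, Fin.mk_one, h1, h2, h3, h4] <;> simp

/-- Two orthogonal maximally entangled vectors can be brought by local unitaries to
`(|00⟩ + |11⟩)/√2` and, up to a phase, `(|00⟩ - |11⟩)/√2`. -/
theorem exists_params_of_maximallyEntangled {e f : Fin 2 × Fin 2 → ℂ} (hef : star e ⬝ᵥ f = 0)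
    {U V U' V' : Op1} (hU : U ∈ Matrix.unitaryGroup (Fin 2) ℂ)
    (hV : V ∈ Matrix.unitaryGroup (Fin 2) ℂ) (hU' : U' ∈ Matrix.unitaryGroup (Fin 2) ℂ)
    (hV' : V' ∈ Matrix.unitaryGroup (Fin 2) ℂ)
    (he : coeffMatrix ((U ⊗ₖ V) *ᵥ e) = ((√2 / 2 : ℝ) : ℂ) • (1 : Op1))
    (hf : coeffMatrix ((U' ⊗ₖ V') *ᵥ f) = ((√2 / 2 : ℝ) : ℂ) • (1 : Op1))
    {ν₁ ν₂ : ℝ} (h₁ : 0 ≤ ν₁) (h₂ : 0 ≤ ν₂) (hν : ν₁ + ν₂ = 1) :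
    ∃ U ∈ Matrix.unitaryGroup (Fin 2) ℂ, ∃ V ∈ Matrix.unitaryGroup (Fin 2) ℂ,
      ∃ p : Params, p.InRange ∧ p.φ = Real.pi / 2 ∧ p.ν₁ = ν₁ ∧ p.ν₂ = ν₂ ∧
        (U ⊗ₖ V) *ᵥ e = p.ψ₁ ∧ ∃ c : ℂ, c * conj c = 1 ∧ (U ⊗ₖ V) *ᵥ f = c • p.ψ₂ := by
  set k : ℂ := ((√2 / 2 : ℝ) : ℂ) with hk
  have hk0 : k ≠ 0 := by rw [hk, Complex.ofReal_ne_zero]; positivity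
  have hVT := Matrix.transpose_mem_unitaryGroup_iff.2 hV
  have hVT' := Matrix.transpose_mem_unitaryGroup_iff.2 hV'
  set W : Op1 := U * star U' * (star V'ᵀ * Vᵀ) with hWdef
  have hW : W ∈ Matrix.unitaryGroup (Fin 2) ℂ :=
    mul_mem (mul_mem hU (Unitary.star_mem hU')) (mul_mem (Unitary.star_mem hVT') hVT)
  have hfW : coeffMatrix ((U ⊗ₖ V) *ᵥ f) = k • W := by
    rw [coeffMatrix_kronecker_mulVec] at hf ⊢
    have hf' : coeffMatrix f = k • (star U' * star V'ᵀ) := by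
      calc coeffMatrix f = star U' * (U' * coeffMatrix f * V'ᵀ) * star V'ᵀ := by
            rw [Matrix.mul_assoc U', ← Matrix.mul_assoc (star U'),
              Matrix.mem_unitaryGroup_iff'.1 hU', Matrix.one_mul, Matrix.mul_assoc,
              Matrix.mem_unitaryGroup_iff.1 hVT', Matrix.mul_one]
        _ = _ := by rw [hf, Matrix.mul_smul, Matrix.mul_one, Matrix.smul_mul]
    rw [hf', hWdef, Matrix.mul_smul, Matrix.smul_mul]
    simp only [Matrix.mul_assoc]
  -- The coefficient matrices are now `k • 1` and `k • W`, so orthogonality of the vectors says `tr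
  -- W = 0`.
  have htr : W 0 0 + W 1 1 = 0 := by
    rw [← star_mulVec_dotProduct_mulVec (kronecker_mem_unitaryGroup hU hV)] at hef
    have a1 : ∀ i j, ((U ⊗ₖ V) *ᵥ e) (i, j) = (k • (1 : Op1)) i j := fun i j =>
      congrFun (congrFun he i) j
    have a2 : ∀ i j, ((U ⊗ₖ V) *ᵥ f) (i, j) = (k • W) i j := fun i j =>
      congrFun (congrFun hfW i) j
    simp only [dotProduct, Fintype.sum_prod_type, Fin.sum_univ_two, Pi.star_apply, a1, a2,
      Matrix.smul_apply, smul_eq_mul, Complex.star_def, map_mul] at hef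
    have hck : conj k = k := by rw [hk, Complex.conj_ofReal]
    simp only [hck, Matrix.one_apply_eq, map_one, ne_eq, zero_ne_one, one_ne_zero,
      not_false_eq_true, Matrix.one_apply_ne, map_zero] at hef
    apply (mul_eq_zero.1 (_ : k ^ 2 * _ = 0)).resolve_left (pow_ne_zero _ hk0)
    linear_combination hef
  obtain ⟨P, hP, c, hc, hPW⟩ := exists_diagonalize_traceless hW htr
  -- `star P ⊗ Pᵀ` acts on coefficient matrices as conjugation by `P`: it fixes the identity and
  -- diagonalizes `W`.
  refine ⟨star P * U, mul_mem (Unitary.star_mem hP) hU, Pᵀ * V,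
    mul_mem (Matrix.transpose_mem_unitaryGroup_iff.2 hP) hV,
    ⟨ν₁, ν₂, Real.pi / 4, Real.pi / 2, 0, 0⟩,
    ⟨⟨by positivity, by linarith [Real.pi_pos]⟩, ⟨by positivity, le_rfl⟩, ⟨le_rfl, by positivity⟩,
      ⟨le_rfl, by positivity⟩, ⟨h₁, by linarith⟩, ⟨h₂, by linarith⟩, hν⟩, rfl, rfl, rfl, ?_,
    c, hc, ?_⟩
  · apply coeffMatrix_injective
    rw [coeffMatrix_ψ₁_of_eq_pi_div_four rfl, ← kronecker_mulVec_mulVec,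
      coeffMatrix_kronecker_mulVec, he, Matrix.transpose_transpose, Matrix.mul_smul,
      Matrix.mul_one, Matrix.smul_mul, Matrix.mem_unitaryGroup_iff'.1 hP]
  · apply coeffMatrix_injective
    rw [← kronecker_mulVec_mulVec, coeffMatrix_kronecker_mulVec, hfW, Matrix.transpose_transpose,
      Matrix.mul_smul, Matrix.smul_mul, hPW, coeffMatrix_smul, smul_comm]
    congr 1
    obtain ⟨k1, k2, k3, k4⟩ := Params.ψ₂_apply ⟨ν₁, ν₂, Real.pi / 4, Real.pi / 2, 0, 0⟩
    simp only [Real.cos_pi_div_two, Real.sin_pi_div_two, Real.cos_pi_div_four,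
      Real.sin_pi_div_four, ← hk] at k1 k2 k3 k4
    ext i j
    fin_cases i <;> fin_cases j <;>
      simp only [coeffMatrix, Matrix.of_apply, Fin.zero_eta, Fin.mk_one, k1, k2, k3, k4] <;> simp

/-- Spectral decomposition of a two-qubit state of rank at most two. -/
theorem exists_orthonormal_of_rank_le_two {ρ : Op2} (hρ : IsDensity ρ) (hr : ρ.rank ≤ 2) :
    ∃ (e f : Fin 2 × Fin 2 → ℂ) (ν₁ ν₂ : ℝ), star e ⬝ᵥ e = 1 ∧ star f ⬝ᵥ f = 1 ∧
      star e ⬝ᵥ f = 0 ∧ 0 ≤ ν₁ ∧ 0 ≤ ν₂ ∧ ν₁ + ν₂ = 1 ∧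
      ρ = (ν₁ : ℂ) • ketbra e e + (ν₂ : ℂ) • ketbra f f := by
  have hH := hρ.1.isHermitian
  set l := hH.eigenvalues with hl
  set W : Op2 := (hH.eigenvectorUnitary : Op2) with hW
  have hWu : star W * W = 1 := Matrix.mem_unitaryGroup_iff'.1 hH.eigenvectorUnitary.2
  have hspec : ρ = ∑ i, (l i : ℂ) • ketbra (Wᵀ i) (Wᵀ i) := by
    have h := hH.spectral_theorem
    rw [Unitary.conjStarAlgAut_apply] at h
    conv_lhs => rw [h]
    ext a b
    simp only [Matrix.mul_apply, Matrix.sum_apply, Matrix.smul_apply, ketbra_apply,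
      Matrix.transpose_apply, Matrix.diagonal_apply, mul_ite, mul_zero, Finset.sum_ite_eq',
      Finset.mem_univ, if_true, Matrix.star_apply, smul_eq_mul]
    refine Finset.sum_congr rfl fun i _ => ?_
    change W a i * (l i : ℂ) * star (W b i) = _
    ring
  have horth : ∀ i j, star (Wᵀ i) ⬝ᵥ Wᵀ j = (1 : Op2) i j := fun i j => by
    rw [← hWu]; rfl
  have hcard : (Finset.univ.filter fun i => l i ≠ 0).card ≤ 2 := by
    rw [hH.rank_eq_card_non_zero_eigs, Fintype.card_subtype] at hr
    exact hr
  -- The support of the spectrum is padded to exactly two indices, so rank one is included with a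
  -- zero weight.
  obtain ⟨t, hst, -, ht⟩ := Finset.exists_subsuperset_card_eq
    (Finset.filter_subset (fun i => l i ≠ 0) Finset.univ) hcard (by simp)
  obtain ⟨i, j, hij, rfl⟩ := Finset.card_eq_two.1 ht
  have hzero : ∀ m ∉ ({i, j} : Finset (Fin 2 × Fin 2)), l m = 0 := fun m hm => by
    by_contra h
    exact hm (hst (by simpa using h))
  refine ⟨Wᵀ i, Wᵀ j, l i, l j, by rw [horth, Matrix.one_apply_eq],
    by rw [horth, Matrix.one_apply_eq], by rw [horth, Matrix.one_apply_ne hij],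
    hρ.1.eigenvalues_nonneg i, hρ.1.eigenvalues_nonneg j, ?_, ?_⟩
  · have htr := hH.trace_eq_sum_eigenvalues
    rw [hρ.2, ← Finset.sum_subset (Finset.subset_univ {i, j})
      (fun m _ hm => by rw [← hl, hzero m hm]; simp), Finset.sum_pair hij] at htr
    have htr' : ((l i + l j : ℝ) : ℂ) = 1 := by push_cast; exact htr.symm
    exact_mod_cast htr'
  · conv_lhs => rw [hspec]
    rw [← Finset.sum_subset (Finset.subset_univ {i, j})
      (fun m _ hm => by rw [hzero m hm]; simp), Finset.sum_pair hij]

theorem kronecker_mul_mul_eq_state {U V : Op1} {e f : Fin 2 × Fin 2 → ℂ} {p : Params} {c : ℂ}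
    (he : (U ⊗ₖ V) *ᵥ e = p.ψ₁) (hc : c * conj c = 1) (hf : (U ⊗ₖ V) *ᵥ f = c • p.ψ₂) :
    (U ⊗ₖ V) * ((p.ν₁ : ℂ) • ketbra e e + (p.ν₂ : ℂ) • ketbra f f) * (U ⊗ₖ V)ᴴ = p.state := by
  rw [Matrix.mul_add, Matrix.add_mul, Matrix.mul_smul, Matrix.mul_smul, Matrix.smul_mul,
    Matrix.smul_mul, mul_ketbra_mul, mul_ketbra_mul, he, hf, ketbra_smul_of_unit hc]
  rfl

/-- Every two-qubit state of rank at most two has a normal form. -/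
theorem exists_normal_form {ρ : Op2} (hρ : IsDensity ρ) (hr : ρ.rank ≤ 2) :
    ∃ U ∈ Matrix.unitaryGroup (Fin 2) ℂ, ∃ V ∈ Matrix.unitaryGroup (Fin 2) ℂ,
      ∃ p : Params, p.IsNormal ∧ (U ⊗ₖ V) * ρ * (U ⊗ₖ V)ᴴ = p.state := by
  obtain ⟨e, f, ν₁, ν₂, hee, hff, hef, h₁, h₂, hν, rfl⟩ := exists_orthonormal_of_rank_le_two hρ hr
  obtain ⟨U, hU, V, hV, p, hp, rfl, rfl, he, c, hc, hf⟩ := exists_params hee hff hef h₁ h₂ hν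
  by_cases hθ : p.θ = Real.pi / 4
  swap
  · exact ⟨U, hU, V, hV, p, ⟨hp, fun h => absurd h hθ⟩, kronecker_mul_mul_eq_state he hc hf⟩
  have hfe : star f ⬝ᵥ e = 0 := by rw [Matrix.star_dotProduct, hef, star_zero]
  -- The eigenvectors exchange roles, and with them the weights. If the second is also maximally
  -- entangled, the result has `φ = π/2`, so the alternative `φ = 0`, `α = π/4` never arises here.
  obtain ⟨U', hU', V', hV', p', hp', e₁, e₂, hf', c', hc', he'⟩ :=
    exists_params hff hee hfe h₂ h₁ (by rw [add_comm, hν])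
  by_cases hθ' : p'.θ = Real.pi / 4
  swap
  · refine ⟨U', hU', V', hV', p', ⟨hp', fun h => absurd h hθ'⟩, ?_⟩
    rw [add_comm, ← e₁, ← e₂]
    exact kronecker_mul_mul_eq_state hf' hc' he'
  obtain ⟨U'', hU'', V'', hV'', q, hq, hφ, e₃, e₄, he'', c'', hc'', hf''⟩ :=
    exists_params_of_maximallyEntangled hef hU hV hU' hV'
      (by rw [he, coeffMatrix_ψ₁_of_eq_pi_div_four hθ])
      (by rw [hf', coeffMatrix_ψ₁_of_eq_pi_div_four hθ']) h₁ h₂ hν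
  refine ⟨U'', hU'', V'', hV'', q, ⟨hq, fun _ => Or.inr hφ⟩, ?_⟩
  rw [← e₃, ← e₄]
  exact kronecker_mul_mul_eq_state he'' hc'' hf''

theorem Params.isSeparable_iff (p : Params) (h : p.InRange)
    (hθ : p.θ = Real.pi / 4 → p.φ = 0 ∨ p.φ = Real.pi / 2) :
    IsSeparable p.state ↔ ∃ ξ τ : ℝ, (offDiag p.state ξ τ).IsHermitian :=
  ⟨p.exists_offDiag_isHermitian h hθ, fun ⟨_, _, hM⟩ => p.isSeparable_of_offDiag_isHermitian h hM⟩

end TwoQubit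

end

theorem mainTheorem2 :
    (∀ p : TwoQubit.Params, p.InRange →
      (∃ ξ τ : ℝ, (TwoQubit.offDiag p.state ξ τ).IsHermitian) → TwoQubit.IsSeparable p.state) ∧
    (∀ p : TwoQubit.Params, p.InRange →
      (p.θ = Real.pi / 4 → p.φ = 0 ∨ p.φ = Real.pi / 2) →
      (TwoQubit.IsSeparable p.state ↔
        ∃ ξ τ : ℝ, (TwoQubit.offDiag p.state ξ τ).IsHermitian)) ∧
    (∀ ρ : TwoQubit.Op2, TwoQubit.IsDensity ρ → ρ.rank ≤ 2 →
      ∃ U ∈ Matrix.unitaryGroup (Fin 2) ℂ, ∃ V ∈ Matrix.unitaryGroup (Fin 2) ℂ,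
        ∃ p : TwoQubit.Params, p.IsNormal ∧ (U ⊗ₖ V) * ρ * (U ⊗ₖ V)ᴴ = p.state ∧
          (TwoQubit.IsSeparable ρ ↔
            ∃ ξ τ : ℝ, (TwoQubit.offDiag p.state ξ τ).IsHermitian)) := by
  refine ⟨fun p h ⟨_, _, hM⟩ => p.isSeparable_of_offDiag_isHermitian h hM,
    fun p h hθ => p.isSeparable_iff h hθ, fun ρ hρ hr => ?_⟩
  obtain ⟨U, hU, V, hV, p, hp, hstate⟩ := TwoQubit.exists_normal_form hρ hr
  refine ⟨U, hU, V, hV, p, hp, hstate, ?_⟩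
  rw [← TwoQubit.isSeparable_conj_kronecker_iff hU hV, hstate]
  exact p.isSeparable_iff hp.1 fun h => (hp.2 h).imp_left And.left
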